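/- **Setting.** Let $\mathcal M=(\mathcal X,\mathcal A,H,P,R)$ be an episodic MDP with horizon $H$, a measurable state space $\mathcal X$, a finite action set with $|\mathcal A|=A\ge 1$, fixed initial state $x_1$, next states $x_{h+1}\sim P_h(\cdot\mid x_h,a_h)$ and rewards $r_h\sim R_h(x_h,a_h)$, where all rewards are nonnegative with finite mean and, for every action sequence, $\sum_{h=1}^H r_h\le 1$ almost surely. Write $V^\pi_h,Q^\pi_h$ for the value functions of a Markov policy $\pi$, $V^\star=\sup_\pi V_1^\pi(x_1)$, $Q^\star_h=\sup_\pi Q^\pi_h$, and $\mathbb E_\pi$ for the expectation over an episode under $\pi$. Let $\mathcal F=\mathcal F_1\times\dots\times\mathcal F_H$ be a class of measurable functions $\mathcal X\times\mathcal A\to[0,1]$, with $\mathcal F_{H+1}=\{0\}$; put $(\mathcal T_h g)(x,a)=\mathbb E[r_h+\max_{a'}g(x_{h+1},a')\mid x_h=x,a_h=a]$ and $\mathcal E_hf=f_h-\mathcal T_hf_{h+1}$. Assume $Q^\star_h\in\mathcal F_h$ and $\mathcal T_h\mathcal F_{h+1}\subseteq\mathcal F_h$ for all $h\in[H]$. Let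 $\pi^f$ be a greedy policy of $f$ (ties broken arbitrarily), $\Pi_{\mathcal F}=\{\pi^f:f\in\mathcal F\}$, and for $\epsilon\in(0,1]$ let $\mathrm{expl}(f)$ be the policy that plays $\pi^f$ with probability $1-\epsilon$ and a uniform action with probability $\epsilon$, independently at each step. **Algorithm.** Before each episode $t=1,2,\dots$, compute $\hat f_t\in\mathcal F$ backwards for $h=H,\dots,1$ as any least-squares minimizer, $\hat f_{t,h}\in\arg\min_{g\in\mathcal F_h}\sum(g(x_h,a_h)-r_h-\max_{a'}\hat f_{t,h+1}(x_{h+1},a'))^2$, the sum being over the transitions at step $h$ of all previous episodes; then sample episode $t$ with $\tilde\pi_t=\mathrm{expl}(\hat f_t)$. Let $\mathrm{Reg}(T)=\sum_{t=1}^T(V^\star-V_1^{\tilde\pi_t}(x_1))$. **Gap.** The myopic exploration gap $\alpha(f,\mathcal F)$ is the supremum of $\frac1{\sqrt c}\bigl(V_1^{\pi'}(x_1)-V_1^{\pi^f}(x_1)\bigr)$ over $\pi'\in\Pi_{\mathcal F}$ and $c\ge1$ such that for all $f'\in\mathcal F$ and $h\in[H]$ both $\mathbb E_{\pi'}[(\mathcal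 E_hf')^2(x_h,a_h)]$ and $\mathbb E_{\pi^f}[(\mathcal E_hf')^2(x_h,a_h)]$ are at most $c\,\mathbb E_{\mathrm{expl}(f)}[(\mathcal E_hf')^2(x_h,a_h)]$. Put $\alpha(\mathcal F',\mathcal F)=\inf_{f\in\mathcal F'}\alpha(f,\mathcal F)$ and $\mathcal F'_\lambda=\{f\in\mathcal F:V^\star-V_1^{\pi^f}(x_1)\ge\lambda\}$. **Complexity.** Let $\bar N_{\mathcal F}(r)=\sum_{h=1}^HN_{\mathcal F_h}(r)$ be the sum of the (internal) $\ell_\infty$ covering numbers. For a set $\mathcal G$ of functions, a set $\mathcal D$ of probability measures and $r>0$, let $\dim_{\mathrm{DE}}(\mathcal G,\mathcal D,r)$ be the length of the longest sequence $\rho_1,\dots,\rho_n$ in $\mathcal D$ for which there is $r'\ge r$ such that for each $i$ some $g\in\mathcal G$ has $\bigl(\sum_{j<i}(\mathbb E_{\rho_j}g)^2\bigr)^{1/2}\le r'<|\mathbb E_{\rho_i}g|$. The Bellman Eluder dimension is $\dim_{\mathrm{BE}}(\mathcal F,\Pi_{\mathcal F},r)=\max_{h\in[H]}\dim_{\mathrm{DE}}\bigl(\mathcal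 E_h\mathcal F,\{\text{law of }(x_h,a_h)\text{ under }\pi:\pi\in\Pi_{\mathcal F}\},r\bigr)$. **Theorem (Regret Bound of $\epsilon$-Greedy).** There is a universal $p\in\mathbb N$, and for every $\kappa>0$ a constant $C>0$ depending only on $\kappa$, such that the following holds. Let $T\ge1$, $\delta\in(0,1)$, $\epsilon\in(0,1]$, and let $h\in[1,H]$ be real with $$\alpha(\mathcal F'_\lambda,\mathcal F)\ \ge\ \kappa\,(\epsilon/A)^{h/2}\,\lambda\qquad\text{for all }\lambda\in[0,1].$$ Suppose that $\dim_{\mathrm{BE}}(\mathcal F,\Pi_{\mathcal F},1/\sqrt T)$ and $\bar N_{\mathcal F}(1/T)$ are finite, and put $$d=\max\{1,\dim_{\mathrm{BE}}(\mathcal F,\Pi_{\mathcal F},1/\sqrt T)\},\qquad K=\max\{1,\ln(\bar N_{\mathcal F}(1/T)/\delta)\},\qquad L=1+\ln(AT).$$ Then with probability at least $1-\delta$ $$\mathrm{Reg}(T)\ \le\ \epsilon HT+C\,L^p\sqrt{\frac{h\,A^h\,d\,H^3\,T}{\epsilon^h}\,K}.$$ Furthermore, let $B=\bigl(hHA^hdK/T\bigr)^{1/(h+2)}$.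 If $\min\{1,B\}/\rho_1\le\epsilon\le\rho_2B$ for some $\rho_1,\rho_2\ge1$, then with probability at least $1-\delta$ $$\mathrm{Reg}(T)\ \le\ C\,L^p\,(\rho_1^{h/2}+\rho_2)\,H^{\frac{h+3}{h+2}}\,T^{\frac{h+1}{h+2}}\,\bigl(h\,A^h\,d\,K\bigr)^{\frac1{h+2}};$$ in particular, for $\epsilon=\min\{1,B\}$, this is $\tilde O\bigl(H^{\frac{h+3}{h+2}}T^{\frac{h+1}{h+2}}(hA^hdK)^{\frac1{h+2}}\bigr)$. -/

import Mathlib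

open MeasureTheory ProbabilityTheory

universe u v w

noncomputable section

namespace MyopicRL

/-- An episodic MDP with state space `X` and action space `A`. Time steps are `0, …, H - 1`
(the data with index `≥ H` are never used; the final state may be any state, in particular a fixed
terminal one, as nothing is earned after the last step). At step `h`, in state `x` with action `a`, the reward is
drawn from `R h (x, a)` and, independently, the next state from `P h (x, a)`. -/
structure MDP (X : Type u) (A : Type v) [MeasurableSpace X] [MeasurableSpace A] where
  H : ℕ
  xInit : X
  P : ℕ → Kernel (X × A) X
  R : ℕ → Kernel (X × A) ℝ
  markov_P : ∀ h, IsMarkovKernel (P h)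
  markov_R : ∀ h, IsMarkovKernel (R h)

/-- A (randomized, Markov, time-dependent) policy. -/
structure Policy (X : Type u) (A : Type v) [MeasurableSpace X] [MeasurableSpace A] where
  ker : ℕ → Kernel X A
  markov : ∀ h, IsMarkovKernel (ker h)

/-- A sequence `f = (f_h)_h` of functions of state and action. -/
abbrev ValueFn (X : Type u) (A : Type v) := ℕ → X → A → ℝ

/-- A transition `(x_h, a_h, r_h, x_{h+1})`. -/
abbrev Transition (X : Type u) (A : Type v) := X × A × ℝ × X

section Policies

variable {X : Type u} {A : Type v} [MeasurableSpace X] [MeasurableSpace A]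

/-- The deterministic policy that plays `act h x` in state `x` at step `h`. -/
def Policy.ofAct (act : ℕ → X → A) (hact : ∀ h, Measurable (act h)) : Policy X A where
  ker h := Kernel.deterministic (act h) (hact h)
  markov _ := inferInstance

/-- The policy that plays `(1 - ε) δ_{act h x} + ε Unif(A)` in state `x` at step `h`. -/
def Policy.epsGreedy [Fintype A] [MeasurableSingletonClass A] [Nonempty A]
    (ε : ℝ) (hε : ε ∈ Set.Icc (0 : ℝ) 1)
    (act : ℕ → X → A) (hact : ∀ h, Measurable (act h)) : Policy X A where
  ker h :=
    { toFun := fun x => ENNReal.ofReal (1 - ε) • Measure.dirac (act h x)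
        + ENNReal.ofReal (ε / Fintype.card A) • Measure.count
      measurable' := by
        refine Measure.measurable_of_measurable_coe _ fun s hs => ?_
        simp only [Measure.coe_add, Measure.coe_smul, Pi.add_apply, Pi.smul_apply, smul_eq_mul]
        refine Measurable.add_const (Measurable.const_mul ?_ _) _
        exact (Measure.measurable_coe hs).comp (Measure.measurable_dirac.comp (hact h)) }
  markov h := ⟨fun x => ⟨by
    change (ENNReal.ofReal (1 - ε) • Measure.dirac (act h x)
        + ENNReal.ofReal (ε / Fintype.card A) • Measure.count : Measure A) Set.univ = 1
    have hA : (0 : ℝ) < Fintype.card A := by exact_mod_cast Fintype.card_pos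
    have h1 : (0 : ℝ) ≤ 1 - ε := by linarith [hε.2]
    have h2 : (0 : ℝ) ≤ ε / Fintype.card A := div_nonneg hε.1 hA.le
    simp only [Measure.coe_add, Measure.coe_smul, Pi.add_apply, Pi.smul_apply, smul_eq_mul,
      measure_univ, mul_one, Measure.count_univ, ENat.card_eq_coe_fintype_card]
    have h3 : (((Fintype.card A : ℕ) : ENat) : ENNReal)
        = ENNReal.ofReal (Fintype.card A) := by simp
    rw [h3, ← ENNReal.ofReal_mul h2, div_mul_cancel₀ _ hA.ne', ← ENNReal.ofReal_add h1 hε.1]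
    simp⟩⟩

end Policies

namespace MDP

variable {X : Type u} {A : Type v} [MeasurableSpace X] [MeasurableSpace A]

/-- An episode, as the sequence of its transitions. -/
abbrev Episode (M : MDP X A) := Fin M.H → Transition X A

/-- The law of `(x, a, r, x')` when at step `h` the policy acts in state `x`. -/
def stepKernel (M : MDP X A) (π : Policy X A) (h : ℕ) : Kernel X (Transition X A) :=
  Kernel.id ×ₖ (π.ker h ⊗ₖ (M.R h ×ₖ M.P h))

/-- The joint law of the first `n` transitions and of the state reached after them. -/
def prefixLaw (M : MDP X A) (π : Policy X A) : (n : ℕ) → Measure ((Fin n → Transition X A) × X)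
  | 0 => Measure.dirac (fun i => i.elim0, M.xInit)
  | n + 1 =>
    (M.prefixLaw π n ⊗ₘ (M.stepKernel π n).comap Prod.snd measurable_snd).map
      fun p => (Fin.snoc (α := fun _ => Transition X A) p.1.1 p.2, p.2.2.2.2)

/-- The law `ℙ_π` of an episode. -/
def law (M : MDP X A) (π : Policy X A) : Measure M.Episode :=
  (M.prefixLaw π M.H).map Prod.fst

/-- The occupancy measure of `π` at step `h`: the law of `(x_h, a_h)` under `ℙ_π`. -/
def occ (M : MDP X A) (π : Policy X A) (h : Fin M.H) : Measure (X × A) :=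
  (M.law π).map fun e => ((e h).1, (e h).2.1)

/-- Rewards are nonnegative (with finite mean), and for every action sequence the sum of the rewards
of an episode is almost surely at most `1`. -/
structure RewardBounded (M : MDP X A) : Prop where
  nonneg : ∀ h < M.H, ∀ x a, ∀ᵐ r ∂M.R h (x, a), 0 ≤ r
  integrable : ∀ h < M.H, ∀ x a, Integrable (fun r : ℝ => r) (M.R h (x, a))
  sum_le_one : ∀ a : ℕ → A,
    ∀ᵐ e ∂M.law (Policy.ofAct (fun h _ => a h) fun _ => measurable_const),
      ∑ h, (e h).2.2.1 ≤ 1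

/-- The mean reward. -/
def meanReward (M : MDP X A) (h : ℕ) (x : X) (a : A) : ℝ := ∫ r, r ∂M.R h (x, a)

/-- The value of `π` with `k` steps to go, that is, from step `H - k` on. -/
def valueToGo (M : MDP X A) (π : Policy X A) : ℕ → X → ℝ
  | 0, _ => 0
  | k + 1, x => ∫ a, (M.meanReward (M.H - (k + 1)) x a
      + ∫ y, M.valueToGo π k y ∂M.P (M.H - (k + 1)) (x, a)) ∂π.ker (M.H - (k + 1)) x

/-- The value function `V_h^π`. -/
def V (M : MDP X A) (π : Policy X A) (h : ℕ) (x : X) : ℝ := M.valueToGo π (M.H - h) x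

/-- The Q-function `Q_h^π`. -/
def Q (M : MDP X A) (π : Policy X A) (h : ℕ) (x : X) (a : A) : ℝ :=
  M.meanReward h x a + ∫ y, M.V π (h + 1) y ∂M.P h (x, a)

/-- The return of `π`: its value at the initial state and the first step. -/
def ret (M : MDP X A) (π : Policy X A) : ℝ := M.V π 0 M.xInit

/-- The optimal Q-function. -/
def Qstar (M : MDP X A) (h : ℕ) (x : X) (a : A) : ℝ := ⨆ π : Policy X A, M.Q π h x a

/-- The optimal return. -/
def optRet (M : MDP X A) : ℝ := ⨆ π : Policy X A, M.ret π

/-- The Bellman operator `𝒯_h` (for finite `A`, the supremum over actions is a maximum). -/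
def bellman (M : MDP X A) (h : ℕ) (f : X → A → ℝ) (x : X) (a : A) : ℝ :=
  M.meanReward h x a + ∫ y, (⨆ a', f y a') ∂M.P h (x, a)

/-- The Bellman residual `ℰ_h f = f_h - 𝒯_h f_{h+1}`. -/
def residual (M : MDP X A) (h : ℕ) (f : ValueFn X A) (p : X × A) : ℝ :=
  f h p.1 p.2 - M.bellman h (f (h + 1)) p.1 p.2

end MDP

variable {X : Type u} {A : Type v} [MeasurableSpace X] [MeasurableSpace A]

/-- A function class `ℱ = ℱ_0 × ⋯ × ℱ_{H-1}` of measurable functions with values in `[0, 1]`, extended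
by `ℱ_h = {0}` for `h ≥ H`. -/
structure FnClass (M : MDP X A) where
  part : ℕ → Set (X → A → ℝ)
  measurable : ∀ h, ∀ f ∈ part h, Measurable fun p : X × A => f p.1 p.2
  mem_Icc : ∀ h, ∀ f ∈ part h, ∀ x a, f x a ∈ Set.Icc (0 : ℝ) 1
  terminal : ∀ h, M.H ≤ h → part h = {0}

namespace FnClass

variable {M : MDP X A}

/-- The elements `f = (f_h)_h` of the class. -/
def fns (F : FnClass M) : Set (ValueFn X A) := {f | ∀ h, f h ∈ F.part h}

/-- Realizability and completeness. -/
structure Complete (F : FnClass M) : Prop where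
  realizable : ∀ h < M.H, M.Qstar h ∈ F.part h
  complete : ∀ h < M.H, ∀ f ∈ F.part (h + 1), M.bellman h f ∈ F.part h

/-- The `ℓ_∞` covering number of `ℱ_h` at radius `r`. -/
def coverNum (F : FnClass M) (h : ℕ) (r : ℝ) : ℕ∞ :=
  ⨅ (Z : Set (X → A → ℝ)) (_ : Z ⊆ F.part h)
    (_ : ∀ f ∈ F.part h, ∃ g ∈ Z, ∀ x a, |f x a - g x a| ≤ r), Z.encard

/-- The sum of the covering numbers over the steps. -/
def coverSum (F : FnClass M) (r : ℝ) : ℕ∞ := ∑ h ∈ Finset.range M.H, F.coverNum h r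

end FnClass

/-- A choice of one greedy policy `π^f` for each `f` of the class (ties are broken arbitrarily). -/
structure Greedy {M : MDP X A} (F : FnClass M) where
  act : ValueFn X A → ℕ → X → A
  measurable : ∀ f h, Measurable (act f h)
  greedy : ∀ f ∈ F.fns, ∀ h < M.H, ∀ x a, f h x a ≤ f h x (act f h x)

section Greedy

variable {M : MDP X A} {F : FnClass M}

/-- The greedy policy `π^f`. -/
def Greedy.policy (G : Greedy F) (f : ValueFn X A) : Policy X A :=
  Policy.ofAct (G.act f) (G.measurable f)

/-- The set of greedy policies of the class. -/
def Greedy.policies (G : Greedy F) : Set (Policy X A) := G.policy '' F.fns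

/-- The exploration mapping of `ε`-greedy. -/
def Greedy.explore [Fintype A] [MeasurableSingletonClass A] [Nonempty A] (G : Greedy F)
    (ε : ℝ) (hε : ε ∈ Set.Icc (0 : ℝ) 1) (f : ValueFn X A) : Policy X A :=
  Policy.epsGreedy ε hε (G.act f) (G.measurable f)

/-- The functions of the class whose greedy policy is at least `l` suboptimal. -/
def Greedy.suboptimal (G : Greedy F) (l : ℝ) : Set (ValueFn X A) :=
  {f ∈ F.fns | l ≤ M.optRet - M.ret (G.policy f)}

/-- The myopic exploration gap `α(f, ℱ, Π')` for the exploration mapping `expl`. -/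
def gap (G : Greedy F) (expl : ValueFn X A → Policy X A) (Pi' : Set (Policy X A))
    (f : ValueFn X A) : EReal :=
  ⨆ (π' ∈ Pi') (c : ℝ) (_ : 1 ≤ c)
    (_ : ∀ f' ∈ F.fns, ∀ h : Fin M.H,
      ∫ p, M.residual h f' p ^ 2 ∂M.occ π' h ≤ c * ∫ p, M.residual h f' p ^ 2 ∂M.occ (expl f) h ∧
      ∫ p, M.residual h f' p ^ 2 ∂M.occ (G.policy f) h
        ≤ c * ∫ p, M.residual h f' p ^ 2 ∂M.occ (expl f) h),
    ((1 / √c * (M.ret π' - M.ret (G.policy f)) : ℝ) : EReal)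

/-- The gap `α(ℱ', ℱ)` of a subset `ℱ'` of the class: the infimum of `α(f, ℱ)` over `f ∈ ℱ'`, with
the set of greedy policies of the class as the comparison policies. -/
def gapOn (G : Greedy F) (expl : ValueFn X A → Policy X A) (F' : Set (ValueFn X A)) : EReal :=
  ⨅ f ∈ F', gap G expl G.policies f

end Greedy

/-- `ν` is `ε`-independent of `ρ_0, …, ρ_{n-1}` with respect to `𝒢`. -/
def EpsIndep {S : Type*} [MeasurableSpace S] (𝒢 : Set (S → ℝ)) (ε : ℝ) (ν : Measure S) {n : ℕ}
    (ρ : Fin n → Measure S) : Prop :=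
  ∃ g ∈ 𝒢, √(∑ i, (∫ s, g s ∂ρ i) ^ 2) ≤ ε ∧ ε < |∫ s, g s ∂ν|

/-- The distributional Eluder dimension. -/
def dimDE {S : Type*} [MeasurableSpace S] (𝒢 : Set (S → ℝ)) (D : Set (Measure S)) (ε : ℝ) : ℕ∞ :=
  ⨆ (n : ℕ) (_ : ∃ ρ : Fin n → Measure S, (∀ i, ρ i ∈ D) ∧ ∃ ε' : ℝ, ε ≤ ε' ∧
    ∀ i : Fin n, EpsIndep 𝒢 ε' (ρ i) fun j : Fin i => ρ (Fin.castLE i.isLt.le j)), (n : ℕ∞)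

/-- The Bellman Eluder dimension of the class with respect to a set of policies, which enters through
its occupancy measures. -/
def dimBE {M : MDP X A} (F : FnClass M) (Pi' : Set (Policy X A)) (ε : ℝ) : ℕ∞ :=
  ⨆ h : Fin M.H, dimDE (M.residual h '' F.fns) ((fun π => M.occ π h) '' Pi') ε

/-- The squared loss at step `h` on the data of the episodes `0, …, t - 1`. -/
def sqLoss {M : MDP X A} (data : ℕ → M.Episode) (t : ℕ) (h : Fin M.H) (f f' : X → A → ℝ) : ℝ :=
  ∑ s ∈ Finset.range t,
    (f (data s h).1 (data s h).2.1 - (data s h).2.2.1 - ⨆ a', f' (data s h).2.2.2 a') ^ 2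

/-- A run of fitted Q-iteration with exploration mapping `expl` on a probability space.
`ℋ t` is the information available just before episode `t`, `fhat t` the estimate computed then, and
`ep t` the episode that is sampled next. Ties in the regression are broken arbitrarily. -/
structure Run {M : MDP X A} (F : FnClass M) (expl : ValueFn X A → Policy X A)
    {Ω : Type w} [mΩ : MeasurableSpace Ω] (μ : Measure Ω) where
  ℋ : Filtration ℕ mΩ
  fhat : ℕ → Ω → ValueFn X A
  ep : ℕ → Ω → M.Episode
  /-- The estimate is determined by the available information. -/
  fhat_adapted : ∀ t h x a, Measurable[ℋ t] fun ω => fhat t ω h x a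
  /-- A completed episode is part of the available information. -/
  ep_adapted : ∀ t, Measurable[ℋ (t + 1)] (ep t)
  /-- The estimate lies in the class, and in particular vanishes at the terminal step. -/
  fhat_mem : ∀ t, ∀ᵐ ω ∂μ, fhat t ω ∈ F.fns
  /-- The estimate solves the least-squares problems exactly. -/
  fhat_argmin : ∀ t, ∀ᵐ ω ∂μ, ∀ h : Fin M.H, ∀ g ∈ F.part h,
    sqLoss (fun s => ep s ω) t h (fhat t ω h) (fhat t ω (h + 1))
      ≤ sqLoss (fun s => ep s ω) t h g (fhat t ω (h + 1))
  /-- Given the available information, the episode is sampled with the exploration policy. -/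
  ep_law : ∀ t, ∀ S : Set M.Episode, MeasurableSet S →
    μ[(ep t ⁻¹' S).indicator (fun _ => (1 : ℝ)) | ℋ t]
      =ᵐ[μ] fun ω => (M.law (expl (fhat t ω))).real S

/-- The regret of the sampling policies over the episodes `0, …, T - 1`. -/
def Run.regret {M : MDP X A} {F : FnClass M} {expl : ValueFn X A → Policy X A}
    {Ω : Type w} [MeasurableSpace Ω] {μ : Measure Ω} (run : Run F expl μ) (T : ℕ) (ω : Ω) : ℝ :=
  ∑ t ∈ Finset.range T, (M.optRet - M.ret (expl (run.fhat t ω)))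

end MyopicRL

end

/-!
Completeness makes the fitted Q-iteration a sequence of well-specified regressions, so an
exponential supermartingale and a union bound over covers of the classes show that, with high
probability, every estimate has a small Bellman residual under all earlier exploration policies.
The loss of a greedy policy telescopes into its Bellman residuals, so the myopic gap turns a
suboptimality `l` into a residual proportional to `√c * l` at some step, under a policy whose
squared residuals exploration dominates up to the factor `c`. The Bellman Eluder dimension limits
how often this can happen to functions that fit the past, so at most of the order of `l⁻²` episodes
are `l`-suboptimal, and summing over the levels `l` gives a regret of order `√T`. Exploring costs at
most `ε H` per episode.
-/

noncomputable section

namespace MyopicRL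

attribute [instance] MDP.markov_P MDP.markov_R Policy.markov

variable {X : Type u} {A : Type v} [MeasurableSpace X] [MeasurableSpace A]

namespace MDP

/-- The prefix `p` of an episode, given by its transitions so far and its current state, extended by
the transition `q`. -/
def extendPrefix {n : ℕ} (p : (Fin n → Transition X A) × X) (q : Transition X A) :
    (Fin (n + 1) → Transition X A) × X :=
  (Fin.snoc (α := fun _ => Transition X A) p.1 q, q.2.2.2)

@[fun_prop]
theorem measurable_extendPrefix (n : ℕ) :
    Measurable fun p : ((Fin n → Transition X A) × X) × Transition X A =>
      extendPrefix p.1 p.2 := by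
  refine Measurable.prodMk (measurable_pi_iff.2 fun i => ?_) (by fun_prop)
  refine Fin.lastCases ?_ (fun j => ?_) i
  · simp only [Fin.snoc_last]; fun_prop
  · simp only [Fin.snoc_castSucc]; fun_prop

section Laws

variable (M : MDP X A) (π : Policy X A)

instance isMarkovKernel_stepKernel (h : ℕ) : IsMarkovKernel (M.stepKernel π h) := by
  unfold stepKernel; infer_instance

theorem prefixLaw_succ (n : ℕ) :
    M.prefixLaw π (n + 1)
      = (M.prefixLaw π n ⊗ₘ (M.stepKernel π n).comap Prod.snd measurable_snd).map
          fun p => extendPrefix p.1 p.2 :=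
  rfl

instance isProbabilityMeasure_prefixLaw (n : ℕ) : IsProbabilityMeasure (M.prefixLaw π n) := by
  induction n with
  | zero => unfold prefixLaw; infer_instance
  | succ n ih =>
    rw [prefixLaw_succ]
    exact Measure.isProbabilityMeasure_map (measurable_extendPrefix n).aemeasurable

instance isProbabilityMeasure_law : IsProbabilityMeasure (M.law π) :=
  Measure.isProbabilityMeasure_map measurable_fst.aemeasurable

/-- The law of the state `x_n`. -/
def stateLaw (n : ℕ) : Measure X := (M.prefixLaw π n).map Prod.snd

instance isProbabilityMeasure_stateLaw (n : ℕ) : IsProbabilityMeasure (M.stateLaw π n) :=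
  Measure.isProbabilityMeasure_map measurable_snd.aemeasurable

/-- The law of `(x_n, a_n)`: the occupancy measure, but for every `n : ℕ` and not only below the
horizon. -/
def stateActionLaw (n : ℕ) : Measure (X × A) := M.stateLaw π n ⊗ₘ π.ker n

instance isProbabilityMeasure_stateActionLaw (n : ℕ) :
    IsProbabilityMeasure (M.stateActionLaw π n) := by
  unfold stateActionLaw; infer_instance

/-- The law of the transition `(x_n, a_n, r_n, x_{n+1})`. -/
def transitionLaw (n : ℕ) : Measure (Transition X A) :=
  (M.stateActionLaw π n ⊗ₘ (M.R n ×ₖ M.P n)).map fun p => (p.1.1, p.1.2, p.2)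

instance isProbabilityMeasure_transitionLaw (n : ℕ) : IsProbabilityMeasure (M.transitionLaw π n) :=
  Measure.isProbabilityMeasure_map (by fun_prop)

theorem stepKernel_apply (n : ℕ) (x : X) :
    M.stepKernel π n x = ((π.ker n ⊗ₖ (M.R n ×ₖ M.P n)) x).map (Prod.mk x) := by
  rw [stepKernel, Kernel.prod_apply, Kernel.id_apply, Measure.dirac_prod]

theorem lintegral_stepKernel (n : ℕ) (x : X) {φ : Transition X A → ENNReal} (hφ : Measurable φ) :
    ∫⁻ p, φ p ∂M.stepKernel π n x
      = ∫⁻ a, ∫⁻ q, φ (x, a, q) ∂(M.R n ×ₖ M.P n) (x, a) ∂π.ker n x := by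
  rw [stepKernel_apply, lintegral_map hφ (by fun_prop),
    Kernel.lintegral_compProd _ _ _ (by fun_prop)]

theorem lintegral_transitionLaw (n : ℕ) {φ : Transition X A → ENNReal} (hφ : Measurable φ) :
    ∫⁻ p, φ p ∂M.transitionLaw π n = ∫⁻ x, ∫⁻ p, φ p ∂M.stepKernel π n x ∂M.stateLaw π n := by
  rw [transitionLaw, lintegral_map hφ (by fun_prop), Measure.lintegral_compProd (by fun_prop),
    stateActionLaw, Measure.lintegral_compProd]
  · exact lintegral_congr fun x => (M.lintegral_stepKernel π n x hφ).symm
  · exact Measurable.lintegral_kernel_prod_right' (κ := M.R n ×ₖ M.P n)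
      (f := fun p : (X × A) × (ℝ × X) => φ (p.1.1, p.1.2, p.2)) (by fun_prop)

theorem lintegral_prefixLaw_succ (n : ℕ) {φ : ((Fin (n + 1) → Transition X A) × X) → ENNReal}
    (hφ : Measurable φ) :
    ∫⁻ p, φ p ∂M.prefixLaw π (n + 1)
      = ∫⁻ p, ∫⁻ q, φ (extendPrefix p q) ∂M.stepKernel π n p.2 ∂M.prefixLaw π n := by
  rw [prefixLaw_succ, lintegral_map hφ (measurable_extendPrefix n)]
  exact Measure.lintegral_compProd (hφ.comp (measurable_extendPrefix n))

theorem prefixLaw_map_last (n : ℕ) :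
    (M.prefixLaw π (n + 1)).map (fun p => p.1 (Fin.last n)) = M.transitionLaw π n := by
  refine Measure.ext_of_lintegral _ fun φ hφ => ?_
  rw [lintegral_map hφ (by fun_prop), lintegral_prefixLaw_succ _ _ _ (by fun_prop),
    lintegral_transitionLaw _ _ _ hφ, stateLaw, lintegral_map hφ.lintegral_kernel measurable_snd]
  simp [extendPrefix]

theorem prefixLaw_map_castSucc (n : ℕ) (i : Fin n) :
    (M.prefixLaw π (n + 1)).map (fun p => p.1 i.castSucc)
      = (M.prefixLaw π n).map fun p => p.1 i := by
  refine Measure.ext_of_lintegral _ fun φ hφ => ?_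
  rw [lintegral_map hφ (by fun_prop), lintegral_prefixLaw_succ _ _ _ (by fun_prop),
    lintegral_map hφ (by fun_prop)]
  simp [extendPrefix]

theorem prefixLaw_map_eval (n : ℕ) (i : Fin n) :
    (M.prefixLaw π n).map (fun p => p.1 i) = M.transitionLaw π i := by
  induction n with
  | zero => exact i.elim0
  | succ n ih =>
    refine Fin.lastCases ?_ (fun j => ?_) i
    · simpa using M.prefixLaw_map_last π n
    · rw [prefixLaw_map_castSucc, ih]; rfl

theorem law_map_eval (h : Fin M.H) : (M.law π).map (fun e => e h) = M.transitionLaw π h := by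
  rw [law, Measure.map_map (by fun_prop) (by fun_prop), ← M.prefixLaw_map_eval π M.H h]
  rfl

theorem transitionLaw_map_stateAction (n : ℕ) :
    (M.transitionLaw π n).map (fun p => (p.1, p.2.1)) = M.stateActionLaw π n := by
  rw [transitionLaw, Measure.map_map (by fun_prop) (by fun_prop)]
  exact Measure.fst_compProd _ _

theorem occ_eq_stateActionLaw (h : Fin M.H) : M.occ π h = M.stateActionLaw π h := by
  rw [occ, ← transitionLaw_map_stateAction, ← law_map_eval,
    Measure.map_map (by fun_prop) (by fun_prop)]
  rfl

instance isProbabilityMeasure_occ (h : Fin M.H) : IsProbabilityMeasure (M.occ π h) := by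
  rw [occ_eq_stateActionLaw]; infer_instance

theorem transitionLaw_map_reward (n : ℕ) :
    (M.transitionLaw π n).map (fun p => ((p.1, p.2.1), p.2.2.1))
      = M.stateActionLaw π n ⊗ₘ M.R n := by
  rw [transitionLaw, Measure.map_map (by fun_prop) (by fun_prop)]
  refine Measure.ext_of_lintegral _ fun φ hφ => ?_
  rw [lintegral_map hφ (by fun_prop), Measure.lintegral_compProd (by fun_prop),
    Measure.lintegral_compProd hφ]
  refine lintegral_congr fun p => ?_
  rw [Kernel.prod_apply, lintegral_prod _ (by fun_prop)]
  simp

theorem transitionLaw_map_nextState (n : ℕ) :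
    (M.transitionLaw π n).map (fun p => ((p.1, p.2.1), p.2.2.2))
      = M.stateActionLaw π n ⊗ₘ M.P n := by
  rw [transitionLaw, Measure.map_map (by fun_prop) (by fun_prop)]
  refine Measure.ext_of_lintegral _ fun φ hφ => ?_
  rw [lintegral_map hφ (by fun_prop), Measure.lintegral_compProd (by fun_prop),
    Measure.lintegral_compProd hφ]
  refine lintegral_congr fun p => ?_
  rw [Kernel.prod_apply, lintegral_prod _ (by fun_prop)]
  simp

theorem stateLaw_zero : M.stateLaw π 0 = Measure.dirac M.xInit := by
  rw [stateLaw, prefixLaw, Measure.map_dirac' measurable_snd]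

theorem transitionLaw_map_snd_snd_snd (n : ℕ) :
    (M.transitionLaw π n).map (fun p => p.2.2.2) = M.stateLaw π (n + 1) := by
  refine Measure.ext_of_lintegral _ fun φ hφ => ?_
  rw [stateLaw, lintegral_map hφ (by fun_prop), lintegral_map hφ measurable_snd,
    lintegral_prefixLaw_succ _ _ _ (by fun_prop), lintegral_transitionLaw _ _ _ (by fun_prop),
    stateLaw, lintegral_map (Measurable.lintegral_kernel (by fun_prop)) measurable_snd]
  rfl

theorem stateLaw_succ (n : ℕ) :
    M.stateLaw π (n + 1) = (M.stateActionLaw π n ⊗ₘ M.P n).map Prod.snd := by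
  rw [← transitionLaw_map_snd_snd_snd, ← transitionLaw_map_nextState,
    Measure.map_map (by fun_prop) (by fun_prop)]
  rfl

end Laws

section OpenLoop

variable (M : MDP X A)

/-- The policy that plays a fixed sequence of actions; the boundedness of the rewards is assumed for
these policies. -/
abbrev openLoop (a : ℕ → A) : Policy X A := Policy.ofAct (fun h _ => a h) fun _ => measurable_const

theorem prefixLaw_openLoop_congr (n : ℕ) {a b : ℕ → A} (hab : ∀ i < n, a i = b i) :
    M.prefixLaw (openLoop a) n = M.prefixLaw (openLoop b) n := by
  induction n with
  | zero => rw [prefixLaw, prefixLaw]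
  | succ n ih =>
    have hker : (openLoop (X := X) a).ker n = (openLoop b).ker n := by
      simp only [openLoop, Policy.ofAct, hab n n.lt_succ_self]
    simp only [prefixLaw_succ, ih fun i hi => hab i (hi.trans n.lt_succ_self), stepKernel, hker]

theorem ae_prefixLaw_succ (π : Policy X A) (n : ℕ)
    {S : Set ((Fin (n + 1) → Transition X A) × X)} (hS : MeasurableSet S) :
    (∀ᵐ p ∂M.prefixLaw π (n + 1), p ∈ S) ↔ ∀ᵐ p ∂M.prefixLaw π n, ∀ᵐ a ∂π.ker n p.2,
      ∀ᵐ q ∂(M.R n ×ₖ M.P n) (p.2, a), extendPrefix p (p.2, a, q) ∈ S := by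
  rw [prefixLaw_succ, ae_map_iff (p := (· ∈ S)) (by fun_prop) hS,
    Measure.ae_compProd_iff ((measurable_extendPrefix n) hS)]
  refine Filter.eventually_congr (Filter.Eventually.of_forall fun p => ?_)
  have hSp : MeasurableSet {q : Transition X A | extendPrefix p q ∈ S} :=
    ((measurable_extendPrefix n).comp measurable_prodMk_left) hS
  rw [Kernel.comap_apply, stepKernel_apply,
    ae_map_iff (p := fun q => extendPrefix p q ∈ S) (by fun_prop) hSp]
  exact Kernel.ae_compProd_iff (measurable_prodMk_left hSp)

variable [MeasurableSingletonClass A] [Countable A]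

-- Only countably many actions can come last, so they can be fixed one at a time.
theorem ae_prefixLaw_of_openLoop (π : Policy X A) (n : ℕ)
    {S : Set ((Fin n → Transition X A) × X)} (hS : MeasurableSet S)
    (hopen : ∀ a : ℕ → A, ∀ᵐ p ∂M.prefixLaw (openLoop a) n, p ∈ S) :
    ∀ᵐ p ∂M.prefixLaw π n, p ∈ S := by
  induction n with
  | zero =>
    have : Nonempty A := nonempty_of_isProbabilityMeasure (π.ker 0 M.xInit)
    exact hopen fun _ => Classical.arbitrary A
  | succ n ih =>
    have hmeas (a : A) : MeasurableSet {p : (Fin n → Transition X A) × X |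
        ∀ᵐ q ∂(M.R n ×ₖ M.P n) (p.2, a), extendPrefix p (p.2, a, q) ∈ S} := by
      have hpre : MeasurableSet {z : ((Fin n → Transition X A) × X) × (ℝ × X) |
          extendPrefix z.1 (z.1.2, a, z.2) ∉ S} :=
        ((measurable_extendPrefix n).comp (by fun_prop :
          Measurable fun z : ((Fin n → Transition X A) × X) × (ℝ × X) =>
            (z.1, (z.1.2, a, z.2)))) hS.compl
      exact Kernel.measurable_kernel_prodMk_left
        (κ := (M.R n ×ₖ M.P n).comap (fun p : (Fin n → Transition X A) × X => (p.2, a))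
          (by fun_prop)) hpre (measurableSet_singleton 0)
    have hlast (a : A) : ∀ᵐ p ∂M.prefixLaw π n,
        ∀ᵐ q ∂(M.R n ×ₖ M.P n) (p.2, a), extendPrefix p (p.2, a, q) ∈ S := by
      refine ih (hmeas a) fun b => ?_
      have hupdate := (M.ae_prefixLaw_succ _ n hS).1 (hopen (Function.update b n a))
      rw [M.prefixLaw_openLoop_congr n (b := b)
        fun i hi => Function.update_of_ne hi.ne _ _] at hupdate
      filter_upwards [hupdate] with p hp
      simp only [openLoop, Policy.ofAct, Function.update_self, Kernel.deterministic_apply,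
        ae_dirac_eq] at hp
      exact hp
    rw [ae_prefixLaw_succ _ _ _ hS]
    filter_upwards [ae_all_iff.2 hlast] with p hp
    exact Filter.Eventually.of_forall hp

theorem ae_law_of_openLoop (π : Policy X A) {S : Set M.Episode} (hS : MeasurableSet S)
    (hopen : ∀ a : ℕ → A, ∀ᵐ e ∂M.law (openLoop a), e ∈ S) : ∀ᵐ e ∂M.law π, e ∈ S := by
  refine (ae_map_iff measurable_fst.aemeasurable hS).2
    (M.ae_prefixLaw_of_openLoop π M.H (measurable_fst hS) fun a => ?_)
  exact (ae_map_iff measurable_fst.aemeasurable hS).1 (hopen a)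

end OpenLoop

end MDP

theorem integrable_integral_of_compProd {α β : Type*} [MeasurableSpace α] [MeasurableSpace β]
    {μ : Measure α} [SFinite μ] {κ : Kernel α β} [IsSFiniteKernel κ] {f : α × β → ℝ}
    (hf : Integrable f (μ ⊗ₘ κ)) : Integrable (fun x => ∫ y, f (x, y) ∂κ x) μ := by
  rw [Measure.compProd] at hf
  simpa only [Kernel.const_apply, Kernel.prodMkLeft_apply] using hf.integral_compProd

namespace MDP

section Value

variable {M : MDP X A} (π : Policy X A)

theorem measurable_eval (h : Fin M.H) : Measurable fun e : M.Episode => e h :=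
  measurable_pi_apply h

theorem stronglyMeasurable_meanReward (h : ℕ) :
    StronglyMeasurable fun p : X × A => M.meanReward h p.1 p.2 :=
  StronglyMeasurable.integral_kernel_prod_right' (κ := M.R h)
    (f := fun q : (X × A) × ℝ => q.2) measurable_snd.stronglyMeasurable

theorem stronglyMeasurable_integral_P (h : ℕ) {g : X → ℝ} (hg : StronglyMeasurable g) :
    StronglyMeasurable fun p : X × A => ∫ y, g y ∂M.P h p :=
  StronglyMeasurable.integral_kernel_prod_right' (κ := M.P h)
    (f := fun q : (X × A) × X => g q.2) (hg.comp_measurable measurable_snd)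

theorem stronglyMeasurable_valueToGo (k : ℕ) : StronglyMeasurable (M.valueToGo π k) := by
  induction k with
  | zero => exact stronglyMeasurable_const
  | succ k ih =>
    exact StronglyMeasurable.integral_kernel_prod_right' (κ := π.ker (M.H - (k + 1)))
      ((stronglyMeasurable_meanReward _).add (stronglyMeasurable_integral_P _ ih))

theorem integrable_snd_compProd_P {h : ℕ} {g : X → ℝ} (hg : Integrable g (M.stateLaw π (h + 1))) :
    Integrable (fun q : (X × A) × X => g q.2) (M.stateActionLaw π h ⊗ₘ M.P h) := by
  rw [stateLaw_succ] at hg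
  exact hg.comp_measurable measurable_snd

theorem integral_integral_P {h : ℕ} {g : X → ℝ} (hg : Integrable g (M.stateLaw π (h + 1))) :
    ∫ p, ∫ y, g y ∂M.P h p ∂M.stateActionLaw π h = ∫ x, g x ∂M.stateLaw π (h + 1) := by
  rw [← Measure.integral_compProd (integrable_snd_compProd_P π hg)]
  rw [stateLaw_succ] at hg ⊢
  exact (integral_map measurable_snd.aemeasurable hg.aestronglyMeasurable).symm

namespace RewardBounded

theorem ae_transitionLaw_nonneg (hM : M.RewardBounded) {h : ℕ} (hh : h < M.H) :
    ∀ᵐ p ∂M.transitionLaw π h, 0 ≤ p.2.2.1 := by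
  have hcomp : ∀ᵐ q ∂M.stateActionLaw π h ⊗ₘ M.R h, 0 ≤ q.2 :=
    Measure.ae_compProd_of_ae_ae (measurableSet_le measurable_const measurable_snd)
      (Filter.Eventually.of_forall fun p => hM.nonneg h hh p.1 p.2)
  rw [← transitionLaw_map_reward] at hcomp
  exact ae_of_ae_map (p := fun q : (X × A) × ℝ => 0 ≤ q.2) (by fun_prop) hcomp

theorem ae_law_nonneg (hM : M.RewardBounded) :
    ∀ᵐ e ∂M.law π, ∀ h : Fin M.H, 0 ≤ (e h).2.2.1 := by
  rw [ae_all_iff]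
  intro h
  have hstep := hM.ae_transitionLaw_nonneg π h.2
  rw [← law_map_eval] at hstep
  exact ae_of_ae_map (p := fun q : Transition X A => 0 ≤ q.2.2.1)
    (measurable_eval h).aemeasurable hstep

theorem meanReward_nonneg (hM : M.RewardBounded) {h : ℕ} (hh : h < M.H) (x : X) (a : A) :
    0 ≤ M.meanReward h x a :=
  integral_nonneg_of_ae (hM.nonneg h hh x a)

variable [MeasurableSingletonClass A] [Countable A]

theorem ae_law_sum_le_one (hM : M.RewardBounded) : ∀ᵐ e ∂M.law π, ∑ h, (e h).2.2.1 ≤ 1 :=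
  M.ae_law_of_openLoop π (S := {e | ∑ h, (e h).2.2.1 ≤ 1})
    (measurableSet_le (Finset.measurable_sum _ fun i _ => by fun_prop) measurable_const)
    hM.sum_le_one

theorem ae_transitionLaw_reward_mem_Icc (hM : M.RewardBounded) {h : ℕ} (hh : h < M.H) :
    ∀ᵐ p ∂M.transitionLaw π h, p.2.2.1 ∈ Set.Icc (0 : ℝ) 1 := by
  have hlaw : ∀ᵐ e ∂M.law π, (e ⟨h, hh⟩).2.2.1 ∈ Set.Icc (0 : ℝ) 1 := by
    filter_upwards [hM.ae_law_nonneg π, hM.ae_law_sum_le_one π] with e hnonneg hsum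
    exact ⟨hnonneg _, (Finset.single_le_sum (f := fun i => (e i).2.2.1) (fun i _ => hnonneg i)
      (Finset.mem_univ _)).trans hsum⟩
  rw [show M.transitionLaw π h = _ from (M.law_map_eval π ⟨h, hh⟩).symm]
  exact (ae_map_iff (measurable_eval _).aemeasurable (measurableSet_Icc.preimage (by fun_prop :
    Measurable fun p : Transition X A => p.2.2.1))).2 hlaw

theorem integrable_reward (hM : M.RewardBounded) {h : ℕ} (hh : h < M.H) :
    Integrable (fun p => p.2.2.1) (M.transitionLaw π h) := by
  refine Integrable.of_bound (Measurable.aestronglyMeasurable (by fun_prop)) 1 ?_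
  filter_upwards [hM.ae_transitionLaw_reward_mem_Icc π hh] with p hp
  rw [Real.norm_eq_abs, abs_of_nonneg hp.1]
  exact hp.2

theorem integrable_snd_compProd_R (hM : M.RewardBounded) {h : ℕ} (hh : h < M.H) :
    Integrable (fun q => q.2) (M.stateActionLaw π h ⊗ₘ M.R h) := by
  rw [← transitionLaw_map_reward]
  exact (integrable_map_measure (by fun_prop) (by fun_prop)).2 (hM.integrable_reward π hh)

theorem integrable_meanReward (hM : M.RewardBounded) {h : ℕ} (hh : h < M.H) :
    Integrable (fun p : X × A => M.meanReward h p.1 p.2) (M.stateActionLaw π h) :=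
  integrable_integral_of_compProd (hM.integrable_snd_compProd_R π hh)

theorem integral_meanReward (hM : M.RewardBounded) {h : ℕ} (hh : h < M.H) :
    ∫ p, M.meanReward h p.1 p.2 ∂M.stateActionLaw π h = ∫ p, p.2.2.1 ∂M.transitionLaw π h := by
  have hfubini := Measure.integral_compProd (hM.integrable_snd_compProd_R π hh)
  rw [← transitionLaw_map_reward, integral_map (by fun_prop) (by fun_prop)] at hfubini
  exact hfubini.symm

theorem sum_integral_meanReward_le_one (hM : M.RewardBounded) :
    ∑ h ∈ Finset.range M.H, ∫ p, M.meanReward h p.1 p.2 ∂M.stateActionLaw π h ≤ 1 := by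
  have hint (h : Fin M.H) : Integrable (fun e : M.Episode => (e h).2.2.1) (M.law π) := by
    have hreward := hM.integrable_reward π h.2
    rw [← law_map_eval] at hreward
    exact hreward.comp_measurable (by fun_prop)
  have hmean (h : Fin M.H) : ∫ p, M.meanReward h p.1 p.2 ∂M.stateActionLaw π h
      = ∫ e, (e h).2.2.1 ∂M.law π := by
    rw [hM.integral_meanReward π h.2, ← law_map_eval,
      integral_map (measurable_eval h).aemeasurable
        (Measurable.aestronglyMeasurable (by fun_prop))]
  calc ∑ h ∈ Finset.range M.H, ∫ p, M.meanReward h p.1 p.2 ∂M.stateActionLaw π h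
      = ∫ e, ∑ h, (e h).2.2.1 ∂M.law π := by
        rw [Finset.sum_range, integral_finsetSum _ fun h _ => hint h]
        exact Finset.sum_congr rfl fun h _ => hmean h
    _ ≤ ∫ _, (1 : ℝ) ∂M.law π :=
        integral_mono_ae (integrable_finsetSum _ fun h _ => hint h) (integrable_const _)
          (hM.ae_law_sum_le_one π)
    _ = 1 := by simp

theorem integrable_backup (hM : M.RewardBounded) {h : ℕ} (hh : h < M.H) {g : X → ℝ}
    (hg : Integrable g (M.stateLaw π (h + 1))) :
    Integrable (fun p : X × A => M.meanReward h p.1 p.2 + ∫ y, g y ∂M.P h p)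
      (M.stateActionLaw π h) :=
  (hM.integrable_meanReward π hh).add
    (integrable_integral_of_compProd (integrable_snd_compProd_P π hg))

theorem integral_backup (hM : M.RewardBounded) {h : ℕ} (hh : h < M.H) {g : X → ℝ}
    (hg : Integrable g (M.stateLaw π (h + 1))) :
    ∫ p, (M.meanReward h p.1 p.2 + ∫ y, g y ∂M.P h p) ∂M.stateActionLaw π h
      = ∫ p, M.meanReward h p.1 p.2 ∂M.stateActionLaw π h + ∫ x, g x ∂M.stateLaw π (h + 1) := by
  rw [integral_add (hM.integrable_meanReward π hh)
    (integrable_integral_of_compProd (integrable_snd_compProd_P π hg)), integral_integral_P π hg]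

theorem integrable_valueToGo (hM : M.RewardBounded) {k n : ℕ} (hk : n + k = M.H) :
    Integrable (M.valueToGo π k) (M.stateLaw π n) := by
  induction k generalizing n with
  | zero => exact integrable_const (0 : ℝ)
  | succ k ih =>
    obtain rfl : n = M.H - (k + 1) := by omega
    exact integrable_integral_of_compProd
      (hM.integrable_backup π (by omega) (ih (n := M.H - (k + 1) + 1) (by omega)))

theorem integral_valueToGo (hM : M.RewardBounded) {k n : ℕ} (hk : n + k = M.H) :
    ∫ x, M.valueToGo π k x ∂M.stateLaw π n
      = ∑ h ∈ Finset.Ico n M.H, ∫ p, M.meanReward h p.1 p.2 ∂M.stateActionLaw π h := by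
  induction k generalizing n with
  | zero =>
    rw [Finset.Ico_eq_empty (by omega), Finset.sum_empty]
    exact integral_zero X ℝ
  | succ k ih =>
    obtain rfl : n = M.H - (k + 1) := by omega
    have hnext : M.H - (k + 1) + 1 + k = M.H := by omega
    have hint := hM.integrable_valueToGo π hnext
    rw [Finset.sum_eq_sum_Ico_succ_bot (by omega), ← ih hnext,
      ← hM.integral_backup π (by omega) hint]
    exact (Measure.integral_compProd (hM.integrable_backup π (by omega) hint)).symm

theorem ret_eq_sum_meanReward (hM : M.RewardBounded) :
    M.ret π = ∑ h ∈ Finset.range M.H, ∫ p, M.meanReward h p.1 p.2 ∂M.stateActionLaw π h := by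
  rw [Finset.range_eq_Ico, ← hM.integral_valueToGo π (zero_add M.H), stateLaw_zero,
    integral_dirac' _ _ (stronglyMeasurable_valueToGo π _)]
  rfl

theorem ret_nonneg (hM : M.RewardBounded) : 0 ≤ M.ret π := by
  rw [hM.ret_eq_sum_meanReward]
  exact Finset.sum_nonneg fun h hh => integral_nonneg fun p =>
    hM.meanReward_nonneg (Finset.mem_range.1 hh) _ _

theorem ret_le_one (hM : M.RewardBounded) : M.ret π ≤ 1 := by
  rw [hM.ret_eq_sum_meanReward]
  exact hM.sum_integral_meanReward_le_one π

theorem optRet_le_one (hM : M.RewardBounded) : M.optRet ≤ 1 :=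
  Real.iSup_le (fun π => hM.ret_le_one π) zero_le_one

end RewardBounded

end Value

section Domination

variable {M : MDP X A}

theorem smul_stateActionLaw_le_of_smul_stateLaw_le {π π' : Policy X A} {n : ℕ} {b c : ENNReal}
    (hc : ∀ x, c • π.ker n x ≤ π'.ker n x) (hb : b • M.stateLaw π n ≤ M.stateLaw π' n) :
    (b * c) • M.stateActionLaw π n ≤ M.stateActionLaw π' n := by
  refine Measure.le_intro fun s hs _ => ?_
  rw [Measure.smul_apply, stateActionLaw, stateActionLaw, Measure.compProd_apply hs,
    Measure.compProd_apply hs, smul_eq_mul, mul_assoc,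
    ← lintegral_const_mul _ (Kernel.measurable_kernel_prodMk_left hs), ← smul_eq_mul,
    ← lintegral_smul_measure]
  exact lintegral_mono' hb fun x => hc x _

theorem smul_stateLaw_le {π π' : Policy X A} {c : ENNReal}
    (hc : ∀ h x, c • π.ker h x ≤ π'.ker h x) (n : ℕ) :
    c ^ n • M.stateLaw π n ≤ M.stateLaw π' n := by
  induction n with
  | zero => simp [stateLaw_zero]
  | succ n ih =>
    refine Measure.le_intro fun s hs _ => ?_
    rw [pow_succ, stateLaw_succ, stateLaw_succ, Measure.smul_apply,
      Measure.map_apply measurable_snd hs, Measure.map_apply measurable_snd hs,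
      Measure.compProd_apply (measurable_snd hs), Measure.compProd_apply (measurable_snd hs),
      ← lintegral_smul_measure]
    exact lintegral_mono' (smul_stateActionLaw_le_of_smul_stateLaw_le (hc n) ih) le_rfl

theorem smul_stateActionLaw_le {π π' : Policy X A} {c : ENNReal}
    (hc : ∀ h x, c • π.ker h x ≤ π'.ker h x) (n : ℕ) :
    c ^ (n + 1) • M.stateActionLaw π n ≤ M.stateActionLaw π' n := by
  rw [pow_succ]
  exact smul_stateActionLaw_le_of_smul_stateLaw_le (hc n) (smul_stateLaw_le hc n)

theorem RewardBounded.pow_mul_ret_le [MeasurableSingletonClass A] [Countable A]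
    (hM : M.RewardBounded) {π π' : Policy X A} {c : ℝ} (hc0 : 0 ≤ c) (hc1 : c ≤ 1)
    (hc : ∀ h x, ENNReal.ofReal c • π.ker h x ≤ π'.ker h x) :
    c ^ M.H * M.ret π ≤ M.ret π' := by
  rw [hM.ret_eq_sum_meanReward, hM.ret_eq_sum_meanReward, Finset.mul_sum]
  refine Finset.sum_le_sum fun h hh => ?_
  rw [Finset.mem_range] at hh
  have hnonneg (p : X × A) : 0 ≤ M.meanReward h p.1 p.2 := hM.meanReward_nonneg hh _ _
  calc c ^ M.H * ∫ p, M.meanReward h p.1 p.2 ∂M.stateActionLaw π h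
      ≤ c ^ (h + 1) * ∫ p, M.meanReward h p.1 p.2 ∂M.stateActionLaw π h :=
        mul_le_mul_of_nonneg_right (pow_le_pow_of_le_one hc0 hc1 hh) (integral_nonneg hnonneg)
    _ = ∫ p, M.meanReward h p.1 p.2 ∂(ENNReal.ofReal c ^ (h + 1) • M.stateActionLaw π h) := by
        rw [integral_smul_measure, ENNReal.toReal_pow, ENNReal.toReal_ofReal hc0, smul_eq_mul]
    _ ≤ ∫ p, M.meanReward h p.1 p.2 ∂M.stateActionLaw π' h :=
        integral_mono_measure (smul_stateActionLaw_le hc h)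
          (Filter.Eventually.of_forall hnonneg) (hM.integrable_meanReward π' hh)

end Domination

theorem RewardBounded.ret_sub_le_ret_epsGreedy [MeasurableSingletonClass A] [Fintype A] [Nonempty A]
    {M : MDP X A} (hM : M.RewardBounded) {ε : ℝ} (hε : ε ∈ Set.Icc (0 : ℝ) 1) {act : ℕ → X → A}
    (hact : ∀ h, Measurable (act h)) :
    M.ret (Policy.ofAct act hact) - ε * M.H ≤ M.ret (Policy.epsGreedy ε hε act hact) := by
  have hker (h : ℕ) (x : X) : ENNReal.ofReal (1 - ε) • (Policy.ofAct act hact).ker h x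
      ≤ (Policy.epsGreedy ε hε act hact).ker h x := by
    change _ ≤ ENNReal.ofReal (1 - ε) • Measure.dirac (act h x)
      + ENNReal.ofReal (ε / Fintype.card A) • Measure.count
    rw [Policy.ofAct, Kernel.deterministic_apply]
    exact Measure.le_add_right le_rfl
  have hmono := hM.pow_mul_ret_le (sub_nonneg.2 hε.2) (by linarith [hε.1]) hker
  have hbernoulli := one_add_mul_le_pow (a := -ε) (by linarith [hε.2]) M.H
  rw [← sub_eq_add_neg 1 ε] at hbernoulli
  have hret0 := hM.ret_nonneg (Policy.ofAct act hact)
  have hret1 := hM.ret_le_one (Policy.ofAct act hact)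
  have hεH : 0 ≤ ε * M.H := mul_nonneg hε.1 (Nat.cast_nonneg _)
  nlinarith

end MDP

/-- The value `max_a f(x, a)` of the best action, written as a supremum as in `MDP.bellman`. -/
abbrev maxVal (f : X → A → ℝ) (x : X) : ℝ := ⨆ a, f x a

omit [MeasurableSpace X] [MeasurableSpace A] in
theorem le_maxVal {f : X → A → ℝ} (hf : ∀ x a, f x a ∈ Set.Icc (0 : ℝ) 1) (x : X) (a : A) :
    f x a ≤ maxVal f x :=
  le_ciSup ⟨1, by rintro _ ⟨a, rfl⟩; exact (hf x a).2⟩ a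

omit [MeasurableSpace X] [MeasurableSpace A] in
theorem maxVal_mem_Icc {f : X → A → ℝ} (hf : ∀ x a, f x a ∈ Set.Icc (0 : ℝ) 1) (x : X) :
    maxVal f x ∈ Set.Icc (0 : ℝ) 1 :=
  ⟨Real.iSup_nonneg fun a => (hf x a).1, Real.iSup_le (fun a => (hf x a).2) zero_le_one⟩

/-- `f` is measurable with values in `[0, 1]`, as are the elements of a function class. -/
structure IsUnitBounded (f : X → A → ℝ) : Prop where
  measurable : Measurable fun p : X × A => f p.1 p.2
  mem_Icc : ∀ x a, f x a ∈ Set.Icc (0 : ℝ) 1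

namespace IsUnitBounded

variable {f : X → A → ℝ}

theorem integrable (hf : IsUnitBounded f) (μ : Measure (X × A)) [IsFiniteMeasure μ] :
    Integrable (fun p => f p.1 p.2) μ :=
  .of_mem_Icc 0 1 hf.measurable.aemeasurable (.of_forall fun _ => hf.mem_Icc _ _)

variable [Countable A]

theorem measurable_maxVal (hf : IsUnitBounded f) : Measurable (maxVal f) :=
  Measurable.iSup fun a => hf.measurable.comp (by fun_prop : Measurable fun x : X => (x, a))

theorem integrable_maxVal (hf : IsUnitBounded f) (μ : Measure X) [IsFiniteMeasure μ] :
    Integrable (maxVal f) μ :=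
  .of_mem_Icc 0 1 hf.measurable_maxVal.aemeasurable (.of_forall (maxVal_mem_Icc hf.mem_Icc))

theorem integral_le_integral_maxVal (hf : IsUnitBounded f) {M : MDP X A} (π : Policy X A)
    (h : ℕ) : ∫ p, f p.1 p.2 ∂M.stateActionLaw π h ≤ ∫ x, maxVal f x ∂M.stateLaw π h := by
  have hmarginal : M.stateLaw π h = (M.stateActionLaw π h).map Prod.fst :=
    (Measure.fst_compProd _ _).symm
  have hmax := hf.integrable_maxVal (M.stateLaw π h)
  rw [hmarginal] at hmax ⊢
  rw [integral_map measurable_fst.aemeasurable hmax.aestronglyMeasurable]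
  exact integral_mono (hf.integrable _) (hmax.comp_measurable measurable_fst)
    fun p => le_maxVal hf.mem_Icc p.1 p.2

end IsUnitBounded

namespace FnClass

variable {M : MDP X A} {F : FnClass M} {f : ValueFn X A}

theorem isUnitBounded {h : ℕ} {g : X → A → ℝ} (hg : g ∈ F.part h) : IsUnitBounded g :=
  ⟨F.measurable h g hg, F.mem_Icc h g hg⟩

theorem eq_zero_of_le (hf : f ∈ F.fns) {h : ℕ} (hh : M.H ≤ h) : f h = 0 := by
  simpa [F.terminal h hh] using hf h

variable [Countable A] [MeasurableSingletonClass A]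

theorem integral_residual (hM : M.RewardBounded) (hf : f ∈ F.fns) (π : Policy X A) {h : ℕ}
    (hh : h < M.H) :
    ∫ p, M.residual h f p ∂M.stateActionLaw π h
      = ∫ p, f h p.1 p.2 ∂M.stateActionLaw π h - ∫ p, M.meanReward h p.1 p.2 ∂M.stateActionLaw π h
        - ∫ x, maxVal (f (h + 1)) x ∂M.stateLaw π (h + 1) := by
  have hmax := (isUnitBounded (hf (h + 1))).integrable_maxVal (M.stateLaw π (h + 1))
  rw [sub_sub, ← hM.integral_backup π hh hmax]
  exact integral_sub ((isUnitBounded (hf h)).integrable _) (hM.integrable_backup π hh hmax)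

theorem sum_integral_residual (hM : M.RewardBounded) (hf : f ∈ F.fns) (π : Policy X A) :
    ∑ h ∈ Finset.range M.H, ∫ p, M.residual h f p ∂M.stateActionLaw π h
      = ∑ h ∈ Finset.range M.H,
          (∫ p, f h p.1 p.2 ∂M.stateActionLaw π h - ∫ x, maxVal (f h) x ∂M.stateLaw π h)
        + maxVal (f 0) M.xInit - M.ret π := by
  have htelescope := Finset.sum_range_sub' (fun h => ∫ x, maxVal (f h) x ∂M.stateLaw π h) M.H
  have hterminal : ∫ x, maxVal (f M.H) x ∂M.stateLaw π M.H = 0 := by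
    simp [maxVal, eq_zero_of_le hf le_rfl]
  have hinitial : ∫ x, maxVal (f 0) x ∂M.stateLaw π 0 = maxVal (f 0) M.xInit := by
    rw [MDP.stateLaw_zero, integral_dirac' _ _
      (isUnitBounded (hf 0)).measurable_maxVal.stronglyMeasurable]
  rw [hterminal, hinitial, sub_zero] at htelescope
  rw [← htelescope, hM.ret_eq_sum_meanReward, ← Finset.sum_add_distrib, ← Finset.sum_sub_distrib]
  refine Finset.sum_congr rfl fun h hh => ?_
  rw [integral_residual hM hf π (Finset.mem_range.1 hh)]
  ring

end FnClass

namespace Greedy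

variable {M : MDP X A} {F : FnClass M} {f : ValueFn X A}

theorem maxVal_eq (G : Greedy F) (hf : f ∈ F.fns) {h : ℕ} (hh : h < M.H) (x : X) :
    maxVal (f h) x = f h x (G.act f h x) :=
  haveI : Nonempty A := ⟨G.act f h x⟩
  le_antisymm (ciSup_le fun a => G.greedy f hf h hh x a) (le_maxVal (F.mem_Icc _ _ (hf h)) _ _)

theorem integral_eq_integral_maxVal (G : Greedy F) (hf : f ∈ F.fns) {h : ℕ} (hh : h < M.H) :
    ∫ p, f h p.1 p.2 ∂M.stateActionLaw (G.policy f) h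
      = ∫ x, maxVal (f h) x ∂M.stateLaw (G.policy f) h := by
  have hint := (FnClass.isUnitBounded (hf h)).integrable (M.stateActionLaw (G.policy f) h)
  rw [MDP.stateActionLaw] at hint ⊢
  rw [Measure.integral_compProd hint]
  refine integral_congr_ae (.of_forall fun x => ?_)
  change ∫ a, f h x a ∂Kernel.deterministic (G.act f h) (G.measurable f h) x = _
  have hmeas : Measurable fun a => f h x a :=
    (F.measurable _ _ (hf h)).comp measurable_prodMk_left
  rw [Kernel.deterministic_apply, integral_dirac' _ _ hmeas.stronglyMeasurable,
    G.maxVal_eq hf hh]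

/-- The policy loss decomposition. Both residual sums telescope; the only loss in the telescoping is
`f_h(x, a) ≤ max f_h(x, ·)`, an equality along the greedy policy. -/
theorem ret_sub_ret_le [Countable A] [MeasurableSingletonClass A] (G : Greedy F)
    (hM : M.RewardBounded) (hf : f ∈ F.fns) (π' : Policy X A) :
    M.ret π' - M.ret (G.policy f)
      ≤ ∑ h : Fin M.H, (∫ p, M.residual h f p ∂M.occ (G.policy f) h
          - ∫ p, M.residual h f p ∂M.occ π' h) := by
  have hloss : ∑ h ∈ Finset.range M.H, (∫ p, f h p.1 p.2 ∂M.stateActionLaw π' h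
      - ∫ x, maxVal (f h) x ∂M.stateLaw π' h) ≤ 0 :=
    Finset.sum_nonpos fun h _ =>
      sub_nonpos.2 ((FnClass.isUnitBounded (hf h)).integral_le_integral_maxVal π' h)
  have hgreedy : ∑ h ∈ Finset.range M.H, (∫ p, f h p.1 p.2 ∂M.stateActionLaw (G.policy f) h
      - ∫ x, maxVal (f h) x ∂M.stateLaw (G.policy f) h) = 0 :=
    Finset.sum_eq_zero fun h hh =>
      sub_eq_zero.2 (G.integral_eq_integral_maxVal hf (Finset.mem_range.1 hh))
  simp_rw [MDP.occ_eq_stateActionLaw]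
  rw [← Finset.sum_range (fun h => ∫ p, M.residual h f p ∂M.stateActionLaw (G.policy f) h
      - ∫ p, M.residual h f p ∂M.stateActionLaw π' h), Finset.sum_sub_distrib,
    FnClass.sum_integral_residual hM hf, FnClass.sum_integral_residual hM hf, hgreedy]
  linarith

end Greedy

section CondExp

variable {Ω E : Type*} [MeasurableSpace E] {m mΩ : MeasurableSpace Ω} {μ : Measure Ω}
  [IsFiniteMeasure μ] {e : Ω → E} {ν : Ω → Measure E} [∀ ω, IsProbabilityMeasure (ν ω)]

theorem condExp_simpleFunc_comp_ae_eq_integral (he : Measurable e)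
    (hlaw : ∀ S, MeasurableSet S →
      μ[(e ⁻¹' S).indicator (fun _ => (1 : ℝ)) | m] =ᵐ[μ] fun ω => (ν ω).real S)
    (φ : SimpleFunc E ℝ) : μ[φ ∘ e | m] =ᵐ[μ] fun ω => ∫ p, φ p ∂ν ω := by
  have hint (ψ : SimpleFunc E ℝ) : Integrable (ψ ∘ e) μ :=
    (SimpleFunc.integrable_of_isFiniteMeasure ψ).comp_measurable he
  induction φ using SimpleFunc.induction with
  | @const c S hS =>
    have hcoe : ⇑(SimpleFunc.piecewise S hS (SimpleFunc.const E c) (SimpleFunc.const E 0))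
        = c • S.indicator fun _ => (1 : ℝ) := by
      ext p
      by_cases hp : p ∈ S <;> simp [hp]
    rw [hcoe]
    filter_upwards [condExp_smul (μ := μ) c ((e ⁻¹' S).indicator fun _ => (1 : ℝ)) m, hlaw S hS]
      with ω hsmul hω
    calc (μ[c • (e ⁻¹' S).indicator (fun _ => (1 : ℝ)) | m]) ω = c * (ν ω).real S := by
          rw [hsmul, Pi.smul_apply, hω, smul_eq_mul]
      _ = ∫ p, (c • S.indicator fun _ => (1 : ℝ)) p ∂ν ω := by
          simp only [Pi.smul_apply]
          rw [integral_smul, integral_indicator_const _ hS, smul_eq_mul, smul_eq_mul, mul_one]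
  | @add φ ψ _ hφ hψ =>
    filter_upwards [condExp_add (hint φ) (hint ψ) m, hφ, hψ] with ω hadd hφω hψω
    calc (μ[φ ∘ e + ψ ∘ e | m]) ω = ∫ p, φ p ∂ν ω + ∫ p, ψ p ∂ν ω := by
          rw [hadd, Pi.add_apply, hφω, hψω]
      _ = ∫ p, (φ + ψ) p ∂ν ω :=
          (integral_add (SimpleFunc.integrable_of_isFiniteMeasure φ)
            (SimpleFunc.integrable_of_isFiniteMeasure ψ)).symm

-- `ν` need not be a kernel, as `ω ↦ ν ω S` is only determined almost everywhere; this rules out the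
-- disintegration lemmas of the library and is why the identity is proved from simple functions.
theorem condExp_comp_ae_eq_integral (hm : m ≤ mΩ) (he : Measurable e)
    (hlaw : ∀ S, MeasurableSet S →
      μ[(e ⁻¹' S).indicator (fun _ => (1 : ℝ)) | m] =ᵐ[μ] fun ω => (ν ω).real S)
    {φ : E → ℝ} (hφ : Measurable φ) {B : ℝ} (hB : ∀ p, |φ p| ≤ B) :
    μ[φ ∘ e | m] =ᵐ[μ] fun ω => ∫ p, φ p ∂ν ω := by
  let φs := hφ.stronglyMeasurable.approxBounded B
  have hB0 (ω : Ω) : 0 ≤ B := (abs_nonneg _).trans (hB (e ω))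
  have hbound (ω : Ω) (n : ℕ) (p : E) : ‖φs n p‖ ≤ B :=
    hφ.stronglyMeasurable.norm_approxBounded_le (hB0 ω) n p
  have hlim (p : E) : Filter.Tendsto (fun n => φs n p) Filter.atTop (nhds (φ p)) :=
    hφ.stronglyMeasurable.tendsto_approxBounded_of_norm_le (hB p)
  have hsimple (n : ℕ) := condExp_simpleFunc_comp_ae_eq_integral he hlaw (φs n)
  have hint (n : ℕ) : Integrable (fun ω => ∫ p, φs n p ∂ν ω) μ :=
    integrable_condExp.congr (hsimple n)
  have hnorm (ω : Ω) {ψ : E → ℝ} (hψ : ∀ p, ‖ψ p‖ ≤ B) : ‖∫ p, ψ p ∂ν ω‖ ≤ B := by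
    simpa using norm_integral_le_of_norm_le_const (μ := ν ω) (.of_forall hψ)
  have hlimν (ω : Ω) : Filter.Tendsto (fun n => ∫ p, φs n p ∂ν ω) Filter.atTop
      (nhds (∫ p, φ p ∂ν ω)) :=
    tendsto_integral_of_dominated_convergence (fun _ => B) (fun n => (φs n).aestronglyMeasurable)
      (integrable_const B) (fun n => .of_forall (hbound ω n)) (.of_forall hlim)
  have hmeas : AEStronglyMeasurable[m] (fun ω => ∫ p, φ p ∂ν ω) μ :=
    ⟨fun ω => Filter.limsup (fun n => (μ[φs n ∘ e | m]) ω) Filter.atTop,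
      (Measurable.limsup fun n => stronglyMeasurable_condExp.measurable).stronglyMeasurable,
      (ae_all_iff.2 hsimple).mono fun ω hω =>
        ((hlimν ω).congr fun n => (hω n).symm).limsup_eq.symm⟩
  have hunique : μ[φ ∘ e | m] =ᵐ[μ] μ[fun ω => ∫ p, φ p ∂ν ω | m] := by
    refine tendsto_condExp_unique (fun n => φs n ∘ e) (fun n ω => ∫ p, φs n p ∂ν ω) _ _
      (fun n => (SimpleFunc.integrable_of_isFiniteMeasure (φs n)).comp_measurable he) hint
      (.of_forall fun ω => hlim (e ω)) (.of_forall hlimν) (fun _ => B) (integrable_const B)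
      (fun _ => B) (integrable_const B) (fun n => .of_forall fun ω => hbound ω n (e ω))
      (fun n => .of_forall fun ω => hnorm ω (hbound ω n)) fun n => ?_
    calc μ[φs n ∘ e | m] =ᵐ[μ] μ[μ[φs n ∘ e | m] | m] := by
          rw [condExp_of_stronglyMeasurable hm stronglyMeasurable_condExp integrable_condExp]
      _ =ᵐ[μ] μ[fun ω => ∫ p, φs n p ∂ν ω | m] := condExp_congr_ae (hsimple n)
  exact hunique.trans (condExp_of_aestronglyMeasurable' hm hmeas
    (.of_bound (hmeas.mono hm) B (.of_forall fun ω => hnorm ω hB)))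

end CondExp

section ExpSupermartingale

variable {Ω : Type*} {mΩ : MeasurableSpace Ω} {μ : Measure Ω} [IsFiniteMeasure μ]

theorem integrable_exp_of_ae_le {f : Ω → ℝ} (hf : Measurable f) {b : ℝ}
    (hb : ∀ᵐ ω ∂μ, f ω ≤ b) : Integrable (fun ω => Real.exp (f ω)) μ := by
  refine .of_bound hf.exp.aestronglyMeasurable (Real.exp b) (hb.mono fun ω hω => ?_)
  rwa [Real.norm_eq_abs, Real.abs_exp, Real.exp_le_exp]

variable {ℋ : Filtration ℕ mΩ} {Y q : ℕ → Ω → ℝ} {B : ℝ}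

theorem integrable_exp_sum_sub (hY : ∀ s, Measurable[ℋ (s + 1)] (Y s))
    (hq : ∀ s, Measurable[ℋ s] (q s)) (hYb : ∀ s, ∀ᵐ ω ∂μ, |Y s ω| ≤ B)
    (hqb : ∀ s, ∀ᵐ ω ∂μ, |q s ω| ≤ B) (t : ℕ) :
    Integrable (fun ω => Real.exp (∑ s ∈ Finset.range t, (q s ω - Y s ω))) μ := by
  refine integrable_exp_of_ae_le (b := ∑ s ∈ Finset.range t, 2 * B)
    (Finset.measurable_sum _ fun s _ => ((hq s).mono (ℋ.le _) le_rfl).sub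
      ((hY s).mono (ℋ.le _) le_rfl)) ?_
  filter_upwards [ae_all_iff.2 hYb, ae_all_iff.2 hqb] with ω hYω hqω
  exact Finset.sum_le_sum fun s _ => by linarith [(abs_le.1 (hYω s)).1, (abs_le.1 (hqω s)).2]

theorem supermartingale_exp_sum_sub (hY : ∀ s, Measurable[ℋ (s + 1)] (Y s))
    (hq : ∀ s, Measurable[ℋ s] (q s)) (hYb : ∀ s, ∀ᵐ ω ∂μ, |Y s ω| ≤ B)
    (hqb : ∀ s, ∀ᵐ ω ∂μ, |q s ω| ≤ B)
    (hcond : ∀ s, μ[fun ω => Real.exp (-Y s ω) | ℋ s] ≤ᵐ[μ] fun ω => Real.exp (-q s ω)) :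
    Supermartingale (fun t ω => Real.exp (∑ s ∈ Finset.range t, (q s ω - Y s ω))) ℋ μ := by
  have hadapted (t : ℕ) : Measurable[ℋ t] fun ω => ∑ s ∈ Finset.range t, (q s ω - Y s ω) :=
    Finset.measurable_sum _ fun s hs =>
      ((hq s).mono (ℋ.mono (Finset.mem_range.1 hs).le) le_rfl).sub
        ((hY s).mono (ℋ.mono (Finset.mem_range.1 hs)) le_rfl)
  have hint := integrable_exp_sum_sub hY hq hYb hqb
  refine supermartingale_nat (fun t => (hadapted t).exp.stronglyMeasurable) hint fun t => ?_
  let W : Ω → ℝ := fun ω => Real.exp (∑ s ∈ Finset.range t, (q s ω - Y s ω) + q t ω)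
  let Z : Ω → ℝ := fun ω => Real.exp (-Y t ω)
  have hfactor : (fun ω => Real.exp (∑ s ∈ Finset.range (t + 1), (q s ω - Y s ω))) = W * Z := by
    ext ω
    rw [Pi.mul_apply, ← Real.exp_add, Finset.sum_range_succ, ← add_sub_assoc, sub_eq_add_neg]
  have hZ : Integrable Z μ :=
    integrable_exp_of_ae_le ((hY t).mono (ℋ.le _) le_rfl).neg
      ((hYb t).mono fun ω hω => (neg_le_abs _).trans hω)
  rw [hfactor]
  filter_upwards [condExp_mul_of_stronglyMeasurable_left
    ((hadapted t).add (hq t)).exp.stronglyMeasurable (hfactor ▸ hint (t + 1)) hZ, hcond t]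
    with ω hpull hω
  calc (μ[W * Z | ℋ t]) ω = W ω * (μ[Z | ℋ t]) ω := hpull
    _ ≤ W ω * Real.exp (-q t ω) := mul_le_mul_of_nonneg_left hω (Real.exp_nonneg _)
    _ = Real.exp (∑ s ∈ Finset.range t, (q s ω - Y s ω)) := by
        rw [← Real.exp_add, add_neg_cancel_right]

theorem measure_log_lt_sum_sub_le {μ : Measure Ω} [IsProbabilityMeasure μ]
    (hY : ∀ s, Measurable[ℋ (s + 1)] (Y s))
    (hq : ∀ s, Measurable[ℋ s] (q s)) (hYb : ∀ s, ∀ᵐ ω ∂μ, |Y s ω| ≤ B)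
    (hqb : ∀ s, ∀ᵐ ω ∂μ, |q s ω| ≤ B)
    (hcond : ∀ s, μ[fun ω => Real.exp (-Y s ω) | ℋ s] ≤ᵐ[μ] fun ω => Real.exp (-q s ω)) (t : ℕ)
    {δ : ℝ} (hδ : 0 < δ) :
    μ {ω | Real.log (1 / δ) < ∑ s ∈ Finset.range t, (q s ω - Y s ω)} ≤ ENNReal.ofReal δ := by
  let S : Ω → ℝ := fun ω => ∑ s ∈ Finset.range t, (q s ω - Y s ω)
  have hsuper := supermartingale_exp_sum_sub hY hq hYb hqb hcond
  have hmean : ∫ ω, Real.exp (S ω) ∂μ ≤ 1 := by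
    simpa [S] using hsuper.setIntegral_le t.zero_le MeasurableSet.univ
  have hmarkov := measure_ge_le_exp_mul_mgf (μ := μ) (X := S) (Real.log (1 / δ)) zero_le_one
    (by simpa only [one_mul] using hsuper.integrable t)
  have htail : μ.real {ω | Real.log (1 / δ) ≤ S ω} ≤ δ := by
    refine hmarkov.trans ?_
    rw [one_div, Real.log_inv, neg_one_mul, neg_neg, Real.exp_log hδ, mgf]
    simpa using mul_le_mul_of_nonneg_left hmean hδ.le
  calc μ {ω | Real.log (1 / δ) < S ω} ≤ μ {ω | Real.log (1 / δ) ≤ S ω} :=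
        measure_mono (Set.ofPred_subset_ofPred.2 fun ω hω => hω.le)
    _ ≤ ENNReal.ofReal δ := by
        rw [← ofReal_measureReal]
        exact ENNReal.ofReal_le_ofReal htail

end ExpSupermartingale

/-- The truncation of a reward to `[0, 1]`. Rewards lie in `[0, 1]` only almost surely, and
truncating them makes the losses bounded everywhere. -/
def clip (r : ℝ) : ℝ := Set.projIcc 0 1 zero_le_one r

theorem clip_mem_Icc (r : ℝ) : clip r ∈ Set.Icc (0 : ℝ) 1 :=
  Subtype.property _

theorem clip_of_mem {r : ℝ} (hr : r ∈ Set.Icc (0 : ℝ) 1) : clip r = r := by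
  rw [clip, Set.projIcc_of_mem _ hr]

theorem measurable_clip : Measurable clip :=
  (continuous_subtype_val.comp continuous_projIcc).measurable

theorem abs_sub_le_one_of_mem_Icc {a b : ℝ} (ha : a ∈ Set.Icc (0 : ℝ) 1)
    (hb : b ∈ Set.Icc (0 : ℝ) 1) : |a - b| ≤ 1 :=
  (abs_sub_le_of_le_of_le ha.1 ha.2 hb.1 hb.2).trans (by norm_num)

/-- The excess of the squared loss of `g` over that of `b`, for the (clipped) regression target
`r + max_a f(x', a)` on a transition `(x, a, r, x')`. -/
def excessLoss (g b f : X → A → ℝ) (p : Transition X A) : ℝ :=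
  (g p.1 p.2.1 - clip p.2.2.1 - maxVal f p.2.2.2) ^ 2
    - (b p.1 p.2.1 - clip p.2.2.1 - maxVal f p.2.2.2) ^ 2

section ExcessLoss

variable {g b f : X → A → ℝ}

omit [MeasurableSpace X] [MeasurableSpace A] in
theorem abs_excessLoss_le_mul (hg : ∀ x a, g x a ∈ Set.Icc (0 : ℝ) 1)
    (hb : ∀ x a, b x a ∈ Set.Icc (0 : ℝ) 1) (hf : ∀ x a, f x a ∈ Set.Icc (0 : ℝ) 1)
    (p : Transition X A) : |excessLoss g b f p| ≤ 4 * |g p.1 p.2.1 - b p.1 p.2.1| := by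
  have hfactor : excessLoss g b f p
      = (g p.1 p.2.1 + b p.1 p.2.1 - 2 * clip p.2.2.1 - 2 * maxVal f p.2.2.2)
        * (g p.1 p.2.1 - b p.1 p.2.1) := by
    rw [excessLoss]
    ring
  have hgp := hg p.1 p.2.1
  have hbp := hb p.1 p.2.1
  have hfp := maxVal_mem_Icc hf p.2.2.2
  have hr := clip_mem_Icc p.2.2.1
  rw [hfactor, abs_mul]
  gcongr
  rw [abs_le]
  constructor <;> linarith [hgp.1, hgp.2, hbp.1, hbp.2, hfp.1, hfp.2, hr.1, hr.2]

omit [MeasurableSpace X] [MeasurableSpace A] in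
theorem abs_excessLoss_le (hg : ∀ x a, g x a ∈ Set.Icc (0 : ℝ) 1)
    (hb : ∀ x a, b x a ∈ Set.Icc (0 : ℝ) 1) (hf : ∀ x a, f x a ∈ Set.Icc (0 : ℝ) 1)
    (p : Transition X A) : |excessLoss g b f p| ≤ 4 :=
  (abs_excessLoss_le_mul hg hb hf p).trans (by
    linarith [abs_sub_le_one_of_mem_Icc (hg p.1 p.2.1) (hb p.1 p.2.1)])

omit [MeasurableSpace X] [MeasurableSpace A] in
theorem exp_neg_excessLoss_le (hg : ∀ x a, g x a ∈ Set.Icc (0 : ℝ) 1)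
    (hb : ∀ x a, b x a ∈ Set.Icc (0 : ℝ) 1) (hf : ∀ x a, f x a ∈ Set.Icc (0 : ℝ) 1)
    (p : Transition X A) :
    Real.exp (-(excessLoss g b f p / 32)) ≤ 1 - excessLoss g b f p / 32
      + (g p.1 p.2.1 - b p.1 p.2.1) ^ 2 / 64 := by
  have hsmall : |-(excessLoss g b f p / 32)| ≤ 1 := by
    rw [abs_neg, abs_div, abs_of_pos (by norm_num : (0 : ℝ) < 32)]
    linarith [abs_excessLoss_le hg hb hf p]
  have htaylor := (abs_le.1 (Real.abs_exp_sub_one_sub_id_le hsmall)).2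
  have hsq : excessLoss g b f p ^ 2 ≤ (4 * |g p.1 p.2.1 - b p.1 p.2.1|) ^ 2 :=
    sq_le_sq.2 ((abs_excessLoss_le_mul hg hb hf p).trans (le_abs_self _))
  rw [mul_pow, sq_abs] at hsq
  linarith

theorem measurable_excessLoss [Countable A] (hg : IsUnitBounded g) (hb : IsUnitBounded b)
    (hf : IsUnitBounded f) : Measurable (excessLoss g b f) := by
  have hstateAction : Measurable fun p : Transition X A => (p.1, p.2.1) := by fun_prop
  have hgp := hg.measurable.comp hstateAction
  have hbp := hb.measurable.comp hstateAction
  have hclip : Measurable fun p : Transition X A => clip p.2.2.1 :=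
    measurable_clip.comp (by fun_prop)
  have hmax : Measurable fun p : Transition X A => maxVal f p.2.2.2 :=
    hf.measurable_maxVal.comp (by fun_prop)
  exact (((hgp.sub hclip).sub hmax).pow_const 2).sub (((hbp.sub hclip).sub hmax).pow_const 2)

end ExcessLoss

theorem integral_mul_compProd {α β : Type*} [MeasurableSpace α] [MeasurableSpace β]
    {μ : Measure α} [SFinite μ] {κ : Kernel α β} [IsSFiniteKernel κ] {D : α → ℝ} {f : β → ℝ}
    (hint : Integrable (fun q => D q.1 * f q.2) (μ ⊗ₘ κ)) :
    ∫ q, D q.1 * f q.2 ∂(μ ⊗ₘ κ) = ∫ p, D p * ∫ y, f y ∂κ p ∂μ := by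
  simp only [Measure.integral_compProd hint, integral_const_mul]

theorem integrable_mul_integral {α β : Type*} [MeasurableSpace α] [MeasurableSpace β]
    {μ : Measure α} [SFinite μ] {κ : Kernel α β} [IsSFiniteKernel κ] {D : α → ℝ} {f : β → ℝ}
    (hint : Integrable (fun q => D q.1 * f q.2) (μ ⊗ₘ κ)) :
    Integrable (fun p => D p * ∫ y, f y ∂κ p) μ := by
  simpa only [integral_const_mul] using integrable_integral_of_compProd hint

section Regression

variable {M : MDP X A}

theorem MDP.integral_transitionLaw_stateAction (π : Policy X A) (h : ℕ) {f : X × A → ℝ}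
    (hf : Measurable f) :
    ∫ p, f (p.1, p.2.1) ∂M.transitionLaw π h = ∫ p, f p ∂M.stateActionLaw π h := by
  rw [← transitionLaw_map_stateAction,
    integral_map (Measurable.aemeasurable (by fun_prop)) hf.aestronglyMeasurable]

variable [MeasurableSingletonClass A] [Countable A] {g f : X → A → ℝ}

namespace MDP.RewardBounded

theorem integral_mul_bellman (hM : M.RewardBounded) (π : Policy X A)
    {h : ℕ} (hh : h < M.H) {D : X × A → ℝ} (hD : Measurable D) {B : ℝ} (hDb : ∀ p, |D p| ≤ B)
    (hf : IsUnitBounded f) :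
    ∫ p, D p * M.bellman h f p.1 p.2 ∂M.stateActionLaw π h
      = ∫ p, D (p.1, p.2.1) * (clip p.2.2.1 + maxVal f p.2.2.2) ∂M.transitionLaw π h := by
  have hreward : Integrable (fun q : (X × A) × ℝ => D q.1 * q.2)
      (M.stateActionLaw π h ⊗ₘ M.R h) :=
    (hM.integrable_snd_compProd_R π hh).bdd_mul (hD.comp measurable_fst).aestronglyMeasurable
      (.of_forall fun q => hDb q.1)
  have hnext : Integrable (fun q : (X × A) × X => D q.1 * maxVal f q.2)
      (M.stateActionLaw π h ⊗ₘ M.P h) :=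
    (integrable_snd_compProd_P π (hf.integrable_maxVal _)).bdd_mul
      (hD.comp measurable_fst).aestronglyMeasurable (.of_forall fun q => hDb q.1)
  have hsplit : ∫ p, D p * M.bellman h f p.1 p.2 ∂M.stateActionLaw π h
      = ∫ q, D q.1 * q.2 ∂(M.stateActionLaw π h ⊗ₘ M.R h)
        + ∫ q, D q.1 * maxVal f q.2 ∂(M.stateActionLaw π h ⊗ₘ M.P h) := by
    rw [integral_mul_compProd (f := fun r => r) hreward,
      integral_mul_compProd (f := maxVal f) hnext,
      ← integral_add (integrable_mul_integral (f := fun r => r) hreward)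
        (integrable_mul_integral (f := maxVal f) hnext)]
    exact integral_congr_ae (.of_forall fun p => mul_add _ _ _)
  rw [← transitionLaw_map_reward] at hreward hsplit
  rw [← transitionLaw_map_nextState] at hnext hsplit
  rw [hsplit, integral_map (by fun_prop) hreward.aestronglyMeasurable,
    integral_map (by fun_prop) hnext.aestronglyMeasurable]
  refine (integral_add (hreward.comp_measurable (by fun_prop))
    (hnext.comp_measurable (by fun_prop))).symm.trans (integral_congr_ae ?_)
  filter_upwards [hM.ae_transitionLaw_reward_mem_Icc π hh] with p hp
  simp only [Function.comp_apply, clip_of_mem hp, mul_add]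

theorem integral_excessLoss (hM : M.RewardBounded) (π : Policy X A) {h : ℕ} (hh : h < M.H)
    (hg : IsUnitBounded g) (hf : IsUnitBounded f) (hb : IsUnitBounded (M.bellman h f)) :
    ∫ p, excessLoss g (M.bellman h f) f p ∂M.transitionLaw π h
      = ∫ p, (g p.1 p.2 - M.bellman h f p.1 p.2) ^ 2 ∂M.stateActionLaw π h := by
  set b := M.bellman h f
  let D : X × A → ℝ := fun p => g p.1 p.2 - b p.1 p.2
  have hD : Measurable D := hg.measurable.sub hb.measurable
  have hDb (p : X × A) : |D p| ≤ 1 := abs_sub_le_one_of_mem_Icc (hg.mem_Icc _ _) (hb.mem_Icc _ _)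
  have hstateAction : Measurable fun p : Transition X A => (p.1, p.2.1) := by fun_prop
  have hintegrable {u : Transition X A → ℝ} (hu : Measurable u) (hub : ∀ p, |u p| ≤ 2) :
      Integrable (fun p => D (p.1, p.2.1) * u p) (M.transitionLaw π h) :=
    (Integrable.of_bound hu.aestronglyMeasurable 2 (.of_forall hub)).bdd_mul
      (hD.comp hstateAction).aestronglyMeasurable (.of_forall fun _ => hDb _)
  have hsq := hintegrable (u := fun p => D (p.1, p.2.1)) (hD.comp hstateAction)
    fun p => (hDb _).trans one_le_two
  have hbell := hintegrable (u := fun p => b p.1 p.2.1) (hb.measurable.comp hstateAction)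
    fun p => by
      have hbp := hb.mem_Icc p.1 p.2.1
      exact abs_le.2 ⟨by linarith [hbp.1], by linarith [hbp.2]⟩
  have htarget := hintegrable (u := fun p => clip p.2.2.1 + maxVal f p.2.2.2)
    ((measurable_clip.comp (by fun_prop)).add (hf.measurable_maxVal.comp (by fun_prop))) fun p => by
      have hr := clip_mem_Icc p.2.2.1
      have hx := maxVal_mem_Icc hf.mem_Icc p.2.2.2
      exact abs_le.2 ⟨by linarith [hr.1, hx.1], by linarith [hr.2, hx.2]⟩
  calc ∫ p, excessLoss g b f p ∂M.transitionLaw π h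
      = ∫ p, D (p.1, p.2.1) * D (p.1, p.2.1) ∂M.transitionLaw π h
        + 2 * (∫ p, D (p.1, p.2.1) * b p.1 p.2.1 ∂M.transitionLaw π h
          - ∫ p, D (p.1, p.2.1) * (clip p.2.2.1 + maxVal f p.2.2.2) ∂M.transitionLaw π h) := by
        rw [← integral_sub hbell htarget, ← integral_const_mul]
        refine .trans (integral_congr_ae (.of_forall fun p => ?_))
          (integral_add hsq ((hbell.sub htarget).const_mul 2))
        simp only [excessLoss, D]
        ring
    _ = ∫ p, D p * D p ∂M.stateActionLaw π h := by
        rw [← hM.integral_mul_bellman π hh hD hDb hf,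
          integral_transitionLaw_stateAction (f := fun p => D p * b p.1 p.2) π h
            (hD.mul hb.measurable),
          integral_transitionLaw_stateAction (f := fun p => D p * D p) π h (hD.mul hD),
          sub_self, mul_zero, add_zero]
    _ = _ := by simp only [sq, D]

theorem integral_exp_neg_excessLoss_le (hM : M.RewardBounded) (π : Policy X A) {h : ℕ}
    (hh : h < M.H) (hg : IsUnitBounded g) (hf : IsUnitBounded f)
    (hb : IsUnitBounded (M.bellman h f)) :
    ∫ p, Real.exp (-(excessLoss g (M.bellman h f) f p / 32)) ∂M.transitionLaw π h
      ≤ Real.exp (-((∫ p, (g p.1 p.2 - M.bellman h f p.1 p.2) ^ 2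
        ∂M.stateActionLaw π h) / 64)) := by
  set b := M.bellman h f
  have hmeas := measurable_excessLoss hg hb hf
  have hbound := abs_excessLoss_le hg.mem_Icc hb.mem_Icc hf.mem_Icc
  have hsqMeas : Measurable fun p : X × A => (g p.1 p.2 - b p.1 p.2) ^ 2 :=
    (hg.measurable.sub hb.measurable).pow_const 2
  have hsq : Integrable (fun p => (g p.1 p.2.1 - b p.1 p.2.1) ^ 2) (M.transitionLaw π h) :=
    .of_mem_Icc 0 1
      (hsqMeas.comp (by fun_prop : Measurable fun p : Transition X A => (p.1, p.2.1))).aemeasurable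
      (.of_forall fun _ => ⟨sq_nonneg _, (sq_le_one_iff_abs_le_one _).2
        (abs_sub_le_one_of_mem_Icc (hg.mem_Icc _ _) (hb.mem_Icc _ _))⟩)
  have hloss : Integrable (excessLoss g b f) (M.transitionLaw π h) :=
    .of_bound hmeas.aestronglyMeasurable 4 (.of_forall hbound)
  have hexp : Integrable (fun p => Real.exp (-(excessLoss g b f p / 32)))
      (M.transitionLaw π h) :=
    integrable_exp_of_ae_le (b := 1) (hmeas.div_const 32).neg (.of_forall fun p => by
      linarith [(abs_le.1 (hbound p)).1])
  have hlinear : Integrable (fun p => 1 - excessLoss g b f p / 32) (M.transitionLaw π h) :=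
    (integrable_const 1).sub (hloss.div_const 32)
  calc ∫ p, Real.exp (-(excessLoss g b f p / 32)) ∂M.transitionLaw π h
      ≤ ∫ p, (1 - excessLoss g b f p / 32 + (g p.1 p.2.1 - b p.1 p.2.1) ^ 2 / 64)
          ∂M.transitionLaw π h :=
        integral_mono hexp (hlinear.add (hsq.div_const 64))
          (exp_neg_excessLoss_le hg.mem_Icc hb.mem_Icc hf.mem_Icc)
    _ = -((∫ p, (g p.1 p.2 - b p.1 p.2) ^ 2 ∂M.stateActionLaw π h) / 64) + 1 := by
        rw [integral_add hlinear (hsq.div_const 64), integral_sub (integrable_const 1)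
          (hloss.div_const 32), integral_div, integral_div, hM.integral_excessLoss π hh hg hf hb,
          integral_transitionLaw_stateAction π h hsqMeas, integral_const, probReal_univ, one_smul]
        ring
    _ ≤ _ := Real.add_one_le_exp _

end MDP.RewardBounded
end Regression

section Approximation

theorem abs_maxVal_sub_le [Nonempty A] {f f' : X → A → ℝ} (hf : IsUnitBounded f)
    (hf' : IsUnitBounded f') {r : ℝ} (hr : ∀ x a, |f x a - f' x a| ≤ r) (x : X) :
    |maxVal f x - maxVal f' x| ≤ r := by
  rw [abs_sub_le_iff, sub_le_iff_le_add, sub_le_iff_le_add]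
  exact ⟨ciSup_le fun a => by linarith [(abs_le.1 (hr x a)).2, le_maxVal hf'.mem_Icc x a],
    ciSup_le fun a => by linarith [(abs_le.1 (hr x a)).1, le_maxVal hf.mem_Icc x a]⟩

theorem MDP.abs_bellman_sub_le [Countable A] [Nonempty A] (M : MDP X A) (h : ℕ)
    {f f' : X → A → ℝ} (hf : IsUnitBounded f) (hf' : IsUnitBounded f') {r : ℝ}
    (hr : ∀ x a, |f x a - f' x a| ≤ r) (x : X) (a : A) :
    |M.bellman h f x a - M.bellman h f' x a| ≤ r := by
  rw [MDP.bellman, MDP.bellman, add_sub_add_left_eq_sub,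
    ← integral_sub (hf.integrable_maxVal _) (hf'.integrable_maxVal _)]
  simpa using norm_integral_le_of_norm_le_const (μ := M.P h (x, a))
    (f := fun y => maxVal f y - maxVal f' y) (.of_forall (abs_maxVal_sub_le hf hf' hr))

theorem abs_sq_sub_sq_le {u v b r : ℝ} (hu : |u| ≤ b) (hv : |v| ≤ b) (huv : |u - v| ≤ r) :
    |u ^ 2 - v ^ 2| ≤ 2 * b * r := by
  rw [sq_sub_sq, abs_mul]
  have hadd : |u + v| ≤ 2 * b := (abs_add_le u v).trans (by linarith)
  exact mul_le_mul hadd huv (abs_nonneg _) ((abs_nonneg _).trans hadd)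

theorem abs_sq_loss_sub_le {u u' w w' c r : ℝ} (hu : u ∈ Set.Icc (0 : ℝ) 1)
    (hu' : u' ∈ Set.Icc (0 : ℝ) 1) (hw : w ∈ Set.Icc (0 : ℝ) 1) (hw' : w' ∈ Set.Icc (0 : ℝ) 1)
    (hc : c ∈ Set.Icc (0 : ℝ) 1) (hur : |u - u'| ≤ r) (hwr : |w - w'| ≤ r) :
    |(u - c - w) ^ 2 - (u' - c - w') ^ 2| ≤ 8 * r := by
  have hbound {a b : ℝ} (ha : a ∈ Set.Icc (0 : ℝ) 1) (hb : b ∈ Set.Icc (0 : ℝ) 1) :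
      |a - c - b| ≤ 2 :=
    abs_le.2 ⟨by linarith [ha.1, hb.2, hc.2], by linarith [ha.2, hb.1, hc.1]⟩
  have hdiff : |(u - c - w) - (u' - c - w')| ≤ 2 * r := by
    rw [show (u - c - w) - (u' - c - w') = (u - u') - (w - w') by ring]
    exact (abs_sub _ _).trans (by linarith)
  linarith [abs_sq_sub_sq_le (hbound hu hw) (hbound hu' hw') hdiff]

theorem abs_excessLoss_sub_le [Nonempty A] {g g' b b' f f' : X → A → ℝ}
    (hg : IsUnitBounded g) (hg' : IsUnitBounded g') (hb : IsUnitBounded b)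
    (hb' : IsUnitBounded b') (hf : IsUnitBounded f) (hf' : IsUnitBounded f') {r : ℝ}
    (hgr : ∀ x a, |g x a - g' x a| ≤ r) (hbr : ∀ x a, |b x a - b' x a| ≤ r)
    (hfr : ∀ x a, |f x a - f' x a| ≤ r) (p : Transition X A) :
    |excessLoss g b f p - excessLoss g' b' f' p| ≤ 16 * r := by
  have hmax := maxVal_mem_Icc hf.mem_Icc p.2.2.2
  have hmax' := maxVal_mem_Icc hf'.mem_Icc p.2.2.2
  have hmaxr := abs_maxVal_sub_le hf hf' hfr p.2.2.2
  have hclip := clip_mem_Icc p.2.2.1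
  rw [excessLoss, excessLoss, sub_sub_sub_comm]
  refine (abs_sub _ _).trans ?_
  linarith [abs_sq_loss_sub_le (hg.mem_Icc p.1 p.2.1) (hg'.mem_Icc p.1 p.2.1) hmax hmax' hclip
      (hgr _ _) hmaxr,
    abs_sq_loss_sub_le (hb.mem_Icc p.1 p.2.1) (hb'.mem_Icc p.1 p.2.1) hmax hmax' hclip
      (hbr _ _) hmaxr]

end Approximation

namespace FnClass

variable {M : MDP X A} {F : FnClass M} {r : ℝ}

theorem exists_finite_cover {h : ℕ} (hfin : F.coverNum h r ≠ ⊤) :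
    ∃ Z : Finset (X → A → ℝ), (∀ g ∈ Z, g ∈ F.part h) ∧
      (∀ f ∈ F.part h, ∃ g ∈ Z, ∀ x a, |f x a - g x a| ≤ r) ∧
      (Z.card : ℕ∞) ≤ F.coverNum h r := by
  have hlt : (⨅ (Z : Set (X → A → ℝ)) (_ : Z ⊆ F.part h)
      (_ : ∀ f ∈ F.part h, ∃ g ∈ Z, ∀ x a, |f x a - g x a| ≤ r), Z.encard)
        < F.coverNum h r + 1 :=
    (ENat.lt_add_one_iff hfin).2 le_rfl
  simp only [iInf_lt_iff] at hlt
  obtain ⟨Z, hZ, hcover, hZlt⟩ := hlt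
  have hle : Z.encard ≤ F.coverNum h r := Order.le_of_lt_add_one hZlt
  have hZfin : Z.Finite := Set.encard_ne_top_iff.1 (ne_top_of_le_ne_top hfin hle)
  lift Z to Finset (X → A → ℝ) using hZfin
  exact ⟨Z, hZ, hcover, Set.encard_coe_eq_coe_finsetCard Z ▸ hle⟩

/-- Each `Z h` is a finite internal `r`-cover of the component `F.part h` in the sup norm. -/
structure IsCover (F : FnClass M) (r : ℝ) (Z : ℕ → Finset (X → A → ℝ)) : Prop where
  mem_part : ∀ h, ∀ g ∈ Z h, g ∈ F.part h
  exists_close : ∀ h, ∀ f ∈ F.part h, ∃ g ∈ Z h, ∀ x a, |f x a - g x a| ≤ r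

theorem coverNum_le_coverSum {h : ℕ} (hh : h < M.H) : F.coverNum h r ≤ F.coverSum r :=
  Finset.single_le_sum (f := fun h => F.coverNum h r) (fun _ _ => zero_le) (Finset.mem_range.2 hh)

theorem one_le_coverSum (hF : F.Complete) {h : ℕ} (hh : h < M.H) : 1 ≤ F.coverSum r := by
  refine le_trans (le_iInf₂ fun Z _ => le_iInf fun hcover => ?_) (coverNum_le_coverSum hh)
  obtain ⟨g, hg, _⟩ := hcover _ (hF.realizable h hh)
  exact Set.one_le_encard_iff_nonempty.2 ⟨g, hg⟩

theorem exists_isCover (hr : 0 ≤ r) {N : ℕ} (hN : F.coverSum r = N) :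
    ∃ Z, F.IsCover r Z ∧ ∑ h ∈ Finset.range M.H, (Z h).card ≤ N ∧ (Z M.H).card = 1 := by
  have hcovers (h : ℕ) : ∃ Z : Finset (X → A → ℝ), (∀ g ∈ Z, g ∈ F.part h) ∧
      (∀ f ∈ F.part h, ∃ g ∈ Z, ∀ x a, |f x a - g x a| ≤ r) ∧
      (h < M.H → (Z.card : ℕ∞) ≤ F.coverNum h r) ∧ (M.H ≤ h → Z.card = 1) := by
    rcases lt_or_ge h M.H with hh | hh
    · obtain ⟨Z, hmem, hclose, hcard⟩ := F.exists_finite_cover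
        (ne_top_of_le_ne_top (ENat.natCast_ne_top N) (hN ▸ F.coverNum_le_coverSum (r := r) hh))
      exact ⟨Z, hmem, hclose, fun _ => hcard, fun hle => absurd hh hle.not_gt⟩
    · refine ⟨{0}, ?_, ?_, fun hlt => absurd hlt hh.not_gt, fun _ => Finset.card_singleton _⟩
      · simp [F.terminal h hh]
      · simpa [F.terminal h hh] using fun (_ : X) (_ : A) => hr
  choose Z hmem hclose hcard hterminal using hcovers
  refine ⟨Z, ⟨hmem, hclose⟩, ?_, hterminal _ le_rfl⟩
  have hsum : ((∑ h ∈ Finset.range M.H, (Z h).card : ℕ) : ℕ∞) ≤ N := by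
    rw [← hN, coverSum, Nat.cast_sum]
    exact Finset.sum_le_sum fun h hh => hcard h (Finset.mem_range.1 hh)
  exact_mod_cast hsum

theorem sum_card_mul_card_le {Z : ℕ → Finset (X → A → ℝ)} {N : ℕ}
    (hN : F.coverSum r = N) (hF : F.Complete)
    (hsum : ∑ h ∈ Finset.range M.H, (Z h).card ≤ N) (hterminal : (Z M.H).card = 1) :
    ∑ h ∈ Finset.range M.H, (Z h).card * (Z (h + 1)).card ≤ N ^ 2 := by
  have hcard {h : ℕ} (hh : h < M.H) : (Z (h + 1)).card ≤ N := by
    rcases (Nat.succ_le_of_lt hh).lt_or_eq with hlt | heq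
    · exact (Finset.single_le_sum (f := fun h => (Z h).card) (fun _ _ => Nat.zero_le _)
        (Finset.mem_range.2 hlt)).trans hsum
    · rw [← Nat.succ_eq_add_one, heq, hterminal]
      exact_mod_cast hN ▸ F.one_le_coverSum (r := r) hF hh
  calc ∑ h ∈ Finset.range M.H, (Z h).card * (Z (h + 1)).card
      ≤ ∑ h ∈ Finset.range M.H, (Z h).card * N :=
        Finset.sum_le_sum fun h hh => Nat.mul_le_mul_left _ (hcard (Finset.mem_range.1 hh))
    _ = (∑ h ∈ Finset.range M.H, (Z h).card) * N := (Finset.sum_mul _ _ _).symm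
    _ ≤ N ^ 2 := by
        rw [sq]
        exact Nat.mul_le_mul_right N hsum

end FnClass

namespace Run

variable {M : MDP X A} {F : FnClass M} {expl : ValueFn X A → Policy X A}
  {Ω : Type w} [MeasurableSpace Ω] {μ : Measure Ω} (run : Run F expl μ)
include run

theorem measurable_ep (t : ℕ) : Measurable (run.ep t) :=
  (run.ep_adapted t).mono (run.ℋ.le _) le_rfl

variable [IsProbabilityMeasure μ]

theorem condExp_comp_ep (t : ℕ) {φ : M.Episode → ℝ} (hφ : Measurable φ)
    {B : ℝ} (hB : ∀ e, |φ e| ≤ B) :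
    μ[φ ∘ run.ep t | run.ℋ t] =ᵐ[μ] fun ω => ∫ e, φ e ∂M.law (expl (run.fhat t ω)) :=
  condExp_comp_ae_eq_integral (run.ℋ.le t) (run.measurable_ep t) (run.ep_law t) hφ hB

theorem ae_ep (t : ℕ) {p : M.Episode → Prop} (hp : MeasurableSet {e | p e})
    (hlaw : ∀ π, ∀ᵐ e ∂M.law π, p e) : ∀ᵐ ω ∂μ, p (run.ep t ω) := by
  have hnull (π : Policy X A) : (M.law π).real {e | p e}ᶜ = 0 := by
    rw [Measure.real, show M.law π {e | p e}ᶜ = 0 from hlaw π, ENNReal.toReal_zero]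
  have hcond := run.ep_law t _ hp.compl
  simp_rw [hnull] at hcond
  have hreal : μ.real (run.ep t ⁻¹' {e | p e}ᶜ) = 0 := by
    rw [← integral_indicator_one (run.measurable_ep t hp.compl),
      ← integral_condExp (run.ℋ.le t)]
    exact (integral_congr_ae hcond).trans (integral_zero _ _)
  exact (measureReal_eq_zero_iff (by finiteness)).1 hreal

theorem measure_log_lt_sum_integral_sub_le {Y φ : M.Episode → ℝ} (hY : Measurable Y)
    (hφ : Measurable φ) {B : ℝ} (hYb : ∀ e, |Y e| ≤ B) (hφb : ∀ e, |φ e| ≤ B)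
    (hexp : ∀ π, ∫ e, Real.exp (-Y e) ∂M.law π ≤ Real.exp (-∫ e, φ e ∂M.law π)) (t : ℕ)
    {δ : ℝ} (hδ : 0 < δ) :
    μ {ω | Real.log (1 / δ) < ∑ s ∈ Finset.range t,
      (∫ e, φ e ∂M.law (expl (run.fhat s ω)) - Y (run.ep s ω))} ≤ ENNReal.ofReal δ := by
  have hexpb (e : M.Episode) : |Real.exp (-Y e)| ≤ Real.exp B := by
    rw [Real.abs_exp]
    exact Real.exp_le_exp.2 ((neg_le_abs _).trans (hYb e))
  have hcond (s : ℕ) := run.condExp_comp_ep s hφ hφb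
  refine le_trans (measure_mono_ae ?_) (measure_log_lt_sum_sub_le (ℋ := run.ℋ)
    (Y := fun s ω => Y (run.ep s ω)) (q := fun s => μ[φ ∘ run.ep s | run.ℋ s]) (B := B)
    (fun s => hY.comp (run.ep_adapted s)) (fun s => stronglyMeasurable_condExp.measurable)
    (fun s => .of_forall fun ω => hYb _)
    (fun s => ae_bdd_abs_condExp_of_ae_bdd_abs (.of_forall fun ω => hφb _)) (fun s => ?_) t hδ)
  · filter_upwards [ae_all_iff.2 hcond] with ω hω hlt
    exact hlt.trans_eq (Finset.sum_congr rfl fun s _ => by rw [hω s])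
  · filter_upwards [run.condExp_comp_ep s hY.neg.exp hexpb, hcond s] with ω hexpω hω
    rw [hω]
    exact hexpω.le.trans (hexp _)

theorem measure_log_lt_sum_sub_excessLoss_le [MeasurableSingletonClass A] [Countable A]
    (hM : M.RewardBounded) (h : Fin M.H) {g f : X → A → ℝ} (hg : IsUnitBounded g)
    (hf : IsUnitBounded f) (hb : IsUnitBounded (M.bellman h f)) (t : ℕ) {δ : ℝ} (hδ : 0 < δ) :
    μ {ω | Real.log (1 / δ) < ∑ s ∈ Finset.range t,
      ((∫ p, (g p.1 p.2 - M.bellman h f p.1 p.2) ^ 2 ∂M.occ (expl (run.fhat s ω)) h) / 64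
        - excessLoss g (M.bellman h f) f (run.ep s ω h) / 32)} ≤ ENNReal.ofReal δ := by
  set b := M.bellman h f
  have heval := M.measurable_eval h
  have hstateAction : Measurable fun e : M.Episode => ((e h).1, (e h).2.1) := by fun_prop
  have hsqMeas : Measurable fun p : X × A => (g p.1 p.2 - b p.1 p.2) ^ 2 :=
    (hg.measurable.sub hb.measurable).pow_const 2
  have hloss := (measurable_excessLoss hg hb hf).div_const 32
  have hsq (π : Policy X A) : ∫ e, (g (e h).1 (e h).2.1 - b (e h).1 (e h).2.1) ^ 2 / 64 ∂M.law π
      = (∫ p, (g p.1 p.2 - b p.1 p.2) ^ 2 ∂M.occ π h) / 64 := by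
    rw [MDP.occ, integral_map hstateAction.aemeasurable hsqMeas.aestronglyMeasurable,
      ← integral_div]
  simp_rw [← hsq]
  refine run.measure_log_lt_sum_integral_sub_le (Y := fun e => excessLoss g b f (e h) / 32)
    (φ := fun e => (g (e h).1 (e h).2.1 - b (e h).1 (e h).2.1) ^ 2 / 64) (B := 1)
    (hloss.comp heval) ((hsqMeas.comp hstateAction).div_const 64) (fun e => ?_) (fun e => ?_)
    (fun π => ?_) t hδ
  · rw [abs_div, abs_of_pos (by norm_num : (0 : ℝ) < 32), div_le_one (by norm_num)]
    linarith [abs_excessLoss_le hg.mem_Icc hb.mem_Icc hf.mem_Icc (e h)]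
  · rw [abs_div, abs_of_pos (by norm_num : (0 : ℝ) < 64), div_le_one (by norm_num), abs_sq]
    linarith [(sq_le_one_iff_abs_le_one _).2
      (abs_sub_le_one_of_mem_Icc (hg.mem_Icc (e h).1 (e h).2.1) (hb.mem_Icc (e h).1 (e h).2.1))]
  · rw [hsq, M.occ_eq_stateActionLaw]
    refine le_trans (le_of_eq ?_) (hM.integral_exp_neg_excessLoss_le π h.2 hg hf hb)
    rw [← M.law_map_eval]
    exact (integral_map heval.aemeasurable hloss.neg.exp.aestronglyMeasurable).symm

end Run

section Confidence

theorem IsUnitBounded.integrable_sq_sub {g b : X → A → ℝ} (hg : IsUnitBounded g)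
    (hb : IsUnitBounded b) (ν : Measure (X × A)) [IsFiniteMeasure ν] :
    Integrable (fun p => (g p.1 p.2 - b p.1 p.2) ^ 2) ν :=
  .of_mem_Icc 0 1 ((hg.measurable.sub hb.measurable).pow_const 2).aemeasurable
    (.of_forall fun p => ⟨sq_nonneg _, (sq_le_one_iff_abs_le_one _).2
      (abs_sub_le_one_of_mem_Icc (hg.mem_Icc p.1 p.2) (hb.mem_Icc p.1 p.2))⟩)

theorem IsUnitBounded.integral_sq_sub_le {g g' b b' : X → A → ℝ} (hg : IsUnitBounded g)
    (hg' : IsUnitBounded g') (hb : IsUnitBounded b) (hb' : IsUnitBounded b') {r : ℝ}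
    (hgr : ∀ x a, |g x a - g' x a| ≤ r) (hbr : ∀ x a, |b x a - b' x a| ≤ r)
    (ν : Measure (X × A)) [IsProbabilityMeasure ν] :
    ∫ p, (g p.1 p.2 - b p.1 p.2) ^ 2 ∂ν ≤ ∫ p, (g' p.1 p.2 - b' p.1 p.2) ^ 2 ∂ν + 4 * r := by
  have hle (p : X × A) :
      (g p.1 p.2 - b p.1 p.2) ^ 2 ≤ (g' p.1 p.2 - b' p.1 p.2) ^ 2 + 4 * r := by
    have hdiff : |(g p.1 p.2 - b p.1 p.2) - (g' p.1 p.2 - b' p.1 p.2)| ≤ 2 * r := by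
      rw [sub_sub_sub_comm]
      exact (abs_sub _ _).trans (by linarith [hgr p.1 p.2, hbr p.1 p.2])
    have hsq := abs_sq_sub_sq_le
      (abs_sub_le_one_of_mem_Icc (hg.mem_Icc p.1 p.2) (hb.mem_Icc p.1 p.2))
      (abs_sub_le_one_of_mem_Icc (hg'.mem_Icc p.1 p.2) (hb'.mem_Icc p.1 p.2)) hdiff
    linarith [(abs_le.1 hsq).2]
  have hint := hg'.integrable_sq_sub hb' ν
  calc ∫ p, (g p.1 p.2 - b p.1 p.2) ^ 2 ∂ν
      ≤ ∫ p, ((g' p.1 p.2 - b' p.1 p.2) ^ 2 + 4 * r) ∂ν :=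
        integral_mono (hg.integrable_sq_sub hb ν) (hint.add (integrable_const _)) hle
    _ = ∫ p, (g' p.1 p.2 - b' p.1 p.2) ^ 2 ∂ν + 4 * r := by
        rw [integral_add hint (integrable_const _), integral_const, probReal_univ, one_smul]

variable {M : MDP X A}

theorem sum_excessLoss_nonpos {h : Fin M.H} {g b f : X → A → ℝ} {data : ℕ → M.Episode} {t : ℕ}
    (hdata : ∀ s, (data s h).2.2.1 ∈ Set.Icc (0 : ℝ) 1)
    (hmin : sqLoss data t h g f ≤ sqLoss data t h b f) :
    ∑ s ∈ Finset.range t, excessLoss g b f (data s h) ≤ 0 := by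
  simp only [excessLoss, clip_of_mem (hdata _), Finset.sum_sub_distrib, sub_nonpos]
  exact hmin

namespace FnClass

variable {F : FnClass M}

theorem measurable_residual (hF : F.Complete) {f : ValueFn X A} (hf : f ∈ F.fns) {h : ℕ}
    (hh : h < M.H) : Measurable (M.residual h f) :=
  (F.measurable _ _ (hf h)).sub (F.measurable _ _ (hF.complete h hh _ (hf (h + 1))))

theorem abs_residual_le_one (hF : F.Complete) {f : ValueFn X A} (hf : f ∈ F.fns) {h : ℕ}
    (hh : h < M.H) (p : X × A) : |M.residual h f p| ≤ 1 :=
  abs_sub_le_one_of_mem_Icc (F.mem_Icc _ _ (hf h) _ _)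
    (F.mem_Icc _ _ (hF.complete h hh _ (hf (h + 1))) _ _)

theorem sum_integral_sq_residual_le [Countable A] [Nonempty A] (hF : F.Complete) {h : Fin M.H}
    {f : ValueFn X A} (hf : f ∈ F.fns) {data : ℕ → M.Episode} {t : ℕ}
    (hdata : ∀ s, (data s h).2.2.1 ∈ Set.Icc (0 : ℝ) 1)
    (hmin : ∀ g ∈ F.part h, sqLoss data t h (f h) (f (h + 1)) ≤ sqLoss data t h g (f (h + 1)))
    {g f' : X → A → ℝ} (hg : g ∈ F.part h) (hf' : f' ∈ F.part (h + 1)) {r : ℝ} (hr : t * r ≤ 1)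
    (hgr : ∀ x a, |f h x a - g x a| ≤ r) (hfr : ∀ x a, |f (h + 1) x a - f' x a| ≤ r)
    {π : ℕ → Policy X A} {c : ℝ}
    (hc : ∑ s ∈ Finset.range t,
      ((∫ p, (g p.1 p.2 - M.bellman h f' p.1 p.2) ^ 2 ∂M.occ (π s) h) / 64
        - excessLoss g (M.bellman h f') f' (data s h) / 32) ≤ c) :
    ∑ s ∈ Finset.range t, ∫ p, M.residual h f p ^ 2 ∂M.occ (π s) h ≤ 36 + 64 * c := by
  have hfh := isUnitBounded (hf h)
  have hfnext := isUnitBounded (hf (h + 1))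
  have hb_mem := hF.complete h h.2 _ (hf (h + 1))
  have hb := isUnitBounded hb_mem
  have hb' := isUnitBounded (hF.complete h h.2 _ hf')
  have hbr := M.abs_bellman_sub_le h hfnext (isUnitBounded hf') hfr
  have hloss : ∑ s ∈ Finset.range t, excessLoss g (M.bellman h f') f' (data s h) ≤ 16 := by
    calc ∑ s ∈ Finset.range t, excessLoss g (M.bellman h f') f' (data s h)
        ≤ ∑ s ∈ Finset.range t,
            (excessLoss (f h) (M.bellman h (f (h + 1))) (f (h + 1)) (data s h) + 16 * r) :=
          Finset.sum_le_sum fun s _ => by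
            linarith [(abs_le.1 (abs_excessLoss_sub_le hfh (isUnitBounded hg) hb hb' hfnext
              (isUnitBounded hf') hgr hbr hfr (data s h))).1]
      _ ≤ 16 := by
          rw [Finset.sum_add_distrib, Finset.sum_const, Finset.card_range, nsmul_eq_mul]
          linarith [sum_excessLoss_nonpos hdata (hmin _ hb_mem)]
  calc ∑ s ∈ Finset.range t, ∫ p, M.residual h f p ^ 2 ∂M.occ (π s) h
      ≤ ∑ s ∈ Finset.range t,
          (∫ p, (g p.1 p.2 - M.bellman h f' p.1 p.2) ^ 2 ∂M.occ (π s) h + 4 * r) :=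
        Finset.sum_le_sum fun s _ => hfh.integral_sq_sub_le (isUnitBounded hg) hb hb' hgr hbr _
    _ ≤ 36 + 64 * c := by
        rw [Finset.sum_add_distrib, Finset.sum_const, Finset.card_range, nsmul_eq_mul]
        rw [Finset.sum_sub_distrib, ← Finset.sum_div, ← Finset.sum_div] at hc
        linarith

/-- Each of the first `T` functions `f t` lies in the class and has cumulative squared Bellman
residual at most `β` under the policies `expl (f s)`, `s < t`. -/
def WithinConfidence (F : FnClass M) (expl : ValueFn X A → Policy X A) (f : ℕ → ValueFn X A)
    (T : ℕ) (β : ℝ) : Prop :=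
  ∀ t < T, f t ∈ F.fns ∧ ∀ h : Fin M.H, ∑ s ∈ Finset.range t,
    ∫ p, M.residual h (f t) p ^ 2 ∂M.occ (expl (f s)) h ≤ β

end FnClass

namespace Run

variable {F : FnClass M} {expl : ValueFn X A → Policy X A} {Ω : Type w} [MeasurableSpace Ω]
  {μ : Measure Ω} (run : Run F expl μ)

/-- The event that the losses of the functions `g` and `f`, at step `h` of the first `t` episodes,
concentrate at confidence level `δ`. -/
def Concentrates (δ : ℝ) (t : ℕ) (h : Fin M.H) (g f : X → A → ℝ) (ω : Ω) : Prop :=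
  ∑ s ∈ Finset.range t,
    ((∫ p, (g p.1 p.2 - M.bellman h f p.1 p.2) ^ 2 ∂M.occ (expl (run.fhat s ω)) h) / 64
      - excessLoss g (M.bellman h f) f (run.ep s ω h) / 32) ≤ Real.log (1 / δ)

variable [MeasurableSingletonClass A] [Countable A] [IsProbabilityMeasure μ]

theorem ae_reward_mem_Icc (hM : M.RewardBounded) :
    ∀ᵐ ω ∂μ, ∀ s, ∀ h : Fin M.H, (run.ep s ω h).2.2.1 ∈ Set.Icc (0 : ℝ) 1 := by
  refine ae_all_iff.2 fun s => ae_all_iff.2 fun h => ?_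
  have hreward : Measurable fun e : M.Episode => (e h).2.2.1 := by fun_prop
  refine run.ae_ep s (p := fun e => (e h).2.2.1 ∈ Set.Icc (0 : ℝ) 1)
    (hreward measurableSet_Icc) fun π => ?_
  have hlaw := hM.ae_transitionLaw_reward_mem_Icc π h.2
  rw [← MDP.law_map_eval] at hlaw
  exact ae_of_ae_map (M.measurable_eval h).aemeasurable hlaw

theorem withinConfidence_of_concentrates [Nonempty A] (hF : F.Complete) {T : ℕ} {δ : ℝ}
    {Z : ℕ → Finset (X → A → ℝ)} (hZ : F.IsCover (1 / (T : ℝ)) Z) (hM : M.RewardBounded) :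
    ∀ᵐ ω ∂μ, (∀ t < T, ∀ h : Fin M.H, ∀ g ∈ Z h, ∀ f ∈ Z (h + 1), run.Concentrates δ t h g f ω) →
      F.WithinConfidence expl (run.fhat · ω) T (36 + 64 * Real.log (1 / δ)) := by
  filter_upwards [ae_all_iff.2 run.fhat_mem, ae_all_iff.2 run.fhat_argmin,
    run.ae_reward_mem_Icc hM] with ω hmem hargmin hreward hconc t ht
  refine ⟨hmem t, fun h => ?_⟩
  obtain ⟨g, hg, hgclose⟩ := hZ.exists_close h _ (hmem t h)
  obtain ⟨f, hf, hfclose⟩ := hZ.exists_close (h + 1) _ (hmem t (h + 1))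
  have hradius : t * (1 / (T : ℝ)) ≤ 1 := by
    rw [mul_one_div]
    exact div_le_one_of_le₀ (by exact_mod_cast ht.le) (Nat.cast_nonneg T)
  exact F.sum_integral_sq_residual_le hF (hmem t) (fun s => hreward s h) (hargmin t h)
    (hZ.mem_part _ _ hg) (hZ.mem_part _ _ hf) hradius hgclose hfclose (hconc t ht h g hg f hf)

theorem measure_exists_not_concentrates_le (hM : M.RewardBounded) (hF : F.Complete) (T : ℕ)
    {δ r : ℝ} (hδ : 0 < δ) {Z : ℕ → Finset (X → A → ℝ)} (hZ : F.IsCover r Z) :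
    μ {ω | ∃ t < T, ∃ h : Fin M.H, ∃ g ∈ Z h, ∃ f ∈ Z (h + 1), ¬ run.Concentrates δ t h g f ω}
      ≤ ((T * ∑ h ∈ Finset.range M.H, (Z h).card * (Z (h + 1)).card : ℕ) : ENNReal)
        * ENNReal.ofReal δ := by
  have hsingle (t : ℕ) (h : Fin M.H) {g f : X → A → ℝ} (hg : g ∈ Z h) (hf : f ∈ Z (h + 1)) :
      μ {ω | ¬ run.Concentrates δ t h g f ω} ≤ ENNReal.ofReal δ := by
    have hf_mem := hZ.mem_part _ _ hf
    simpa only [Concentrates, not_le] using run.measure_log_lt_sum_sub_excessLoss_le hM h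
      (FnClass.isUnitBounded (hZ.mem_part _ _ hg)) (FnClass.isUnitBounded hf_mem)
      (FnClass.isUnitBounded (hF.complete h h.2 _ hf_mem)) t hδ
  calc μ {ω | ∃ t < T, ∃ h : Fin M.H, ∃ g ∈ Z h, ∃ f ∈ Z (h + 1),
        ¬ run.Concentrates δ t h g f ω}
      = μ (⋃ t ∈ Finset.range T, ⋃ h ∈ (Finset.univ : Finset (Fin M.H)), ⋃ g ∈ Z h,
          ⋃ f ∈ Z (h + 1), {ω | ¬ run.Concentrates δ t h g f ω}) := by
        congr 1
        ext ω
        simp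
    _ ≤ ∑ t ∈ Finset.range T, ∑ h : Fin M.H, ∑ g ∈ Z h, ∑ _f ∈ Z (h + 1), ENNReal.ofReal δ :=
        (measure_biUnion_finset_le _ _).trans <| Finset.sum_le_sum fun t _ =>
          (measure_biUnion_finset_le _ _).trans <| Finset.sum_le_sum fun h _ =>
          (measure_biUnion_finset_le _ _).trans <| Finset.sum_le_sum fun _ hg =>
          (measure_biUnion_finset_le _ _).trans <| Finset.sum_le_sum fun _ hf =>
          hsingle t h hg hf
    _ = ((T * ∑ h ∈ Finset.range M.H, (Z h).card * (Z (h + 1)).card : ℕ) : ENNReal)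
          * ENNReal.ofReal δ := by
        rw [Finset.sum_range (fun h => (Z h).card * (Z (h + 1)).card)]
        simp only [Finset.sum_const, nsmul_eq_mul, Finset.card_range]
        push_cast
        simp only [mul_assoc, Finset.sum_mul]

theorem measure_not_withinConfidence_le [Nonempty A] (hM : M.RewardBounded) (hF : F.Complete)
    {T : ℕ} (hT : 0 < T) {N : ℕ} (hNpos : 0 < N) (hN : F.coverSum (1 / (T : ℝ)) = N) {δ : ℝ}
    (hδ : 0 < δ) :
    μ {ω | ¬ F.WithinConfidence expl (run.fhat · ω) T
      (36 + 64 * Real.log (T * (N : ℝ) ^ 2 / δ))}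
      ≤ ENNReal.ofReal δ := by
  obtain ⟨Z, hZ, hsum, hterminal⟩ := F.exists_isCover (one_div_nonneg.2 (Nat.cast_nonneg T)) hN
  have hTN : (0 : ℝ) < T * (N : ℝ) ^ 2 := by positivity
  have hδ' : 0 < δ / (T * (N : ℝ) ^ 2) := div_pos hδ hTN
  rw [← one_div_div δ]
  calc μ {ω | ¬ F.WithinConfidence expl (run.fhat · ω) T
        (36 + 64 * Real.log (1 / (δ / (T * (N : ℝ) ^ 2))))}
      ≤ μ {ω | ∃ t < T, ∃ h : Fin M.H, ∃ g ∈ Z h, ∃ f ∈ Z (h + 1),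
          ¬ run.Concentrates (δ / (T * (N : ℝ) ^ 2)) t h g f ω} := by
        refine measure_mono_ae ?_
        filter_upwards [run.withinConfidence_of_concentrates hF hZ hM] with ω hω hnot
        by_contra hconc
        exact hnot <| hω fun t ht h g hg f hf =>
          by_contra fun hfail => hconc ⟨t, ht, h, g, hg, f, hf, hfail⟩
    _ ≤ ((T * ∑ h ∈ Finset.range M.H, (Z h).card * (Z (h + 1)).card : ℕ) : ENNReal)
          * ENNReal.ofReal (δ / (T * (N : ℝ) ^ 2)) :=
        run.measure_exists_not_concentrates_le hM hF T hδ' hZ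
    _ ≤ ((T * N ^ 2 : ℕ) : ENNReal) * ENNReal.ofReal (δ / (T * (N : ℝ) ^ 2)) := by
        gcongr
        exact F.sum_card_mul_card_le hN hF hsum hterminal
    _ = ENNReal.ofReal δ := by
        rw [← ENNReal.ofReal_natCast, ← ENNReal.ofReal_mul (Nat.cast_nonneg _)]
        congr 1
        push_cast
        exact mul_div_cancel₀ _ hTN.ne'

end Run

end Confidence

section Eluder

theorem exists_coloring {ι : Type*} [LinearOrder ι] (I : Finset ι) (w : ι → ι → ℝ) {B θ : ℝ}
    {n : ℕ} (hB : ∀ i ∈ I, ∑ j ∈ I with j < i, w i j ≤ B) (hn : B < n * θ) :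
    ∃ col : ι → ℕ, (∀ i ∈ I, col i < n) ∧
      ∀ i ∈ I, ∑ j ∈ I with j < i ∧ col j = col i, w i j ≤ θ := by
  induction I using Finset.induction_on_max with
  | empty => exact ⟨fun _ => 0, by simp, by simp⟩
  | insert a s ha ih =>
    have predecessors_insert {i : ι} (hi : i ∈ s) (p : ι → Prop) [DecidablePred p] :
        (insert a s).filter (fun j => j < i ∧ p j) = s.filter (fun j => j < i ∧ p j) := by
      rw [Finset.filter_insert, if_neg fun h => (h.1.trans (ha i hi)).false]
    have predecessors_max (p : ι → Prop) [DecidablePred p] :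
        (insert a s).filter (fun j => j < a ∧ p j) = s.filter p := by
      rw [Finset.filter_insert, if_neg fun h => h.1.false]
      exact Finset.filter_congr fun j hj => and_iff_right (ha j hj)
    obtain ⟨col, hcol, hsum⟩ := ih fun i hi => by
      have hBi := hB i (Finset.mem_insert_of_mem hi)
      rwa [Finset.filter_insert, if_neg fun h => (h.trans (ha i hi)).false] at hBi
    have hBa : ∑ j ∈ s, w a j < (Finset.range n).card • θ := by
      have hBa' := hB a (Finset.mem_insert_self a s)
      rw [Finset.filter_insert, if_neg (lt_irrefl a), Finset.filter_true_of_mem ha] at hBa'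
      simpa only [Finset.card_range, nsmul_eq_mul] using hBa'.trans_lt hn
    obtain ⟨c, hc, hcθ⟩ := Finset.exists_sum_fiber_lt_of_maps_to_of_sum_lt_nsmul
      (fun j hj => Finset.mem_range.2 (hcol j hj)) hBa
    have update_col {j : ι} (hj : j ∈ s) : Function.update col a c j = col j :=
      Function.update_of_ne (ha j hj).ne _ _
    refine ⟨Function.update col a c, fun i hi => ?_, fun i hi => ?_⟩ <;>
      rcases Finset.mem_insert.1 hi with rfl | hi
    · simpa using hc
    · simpa only [update_col hi] using hcol i hi
    · rw [predecessors_max, Function.update_self,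
        Finset.filter_congr fun j hj => by rw [update_col hj]]
      exact hcθ.le
    · rw [predecessors_insert hi, update_col hi,
        Finset.filter_congr fun j hj => by rw [update_col hj]]
      exact hsum i hi

variable {S : Type*} [MeasurableSpace S] {ι : Type*} [LinearOrder ι]
  {𝒢 : Set (S → ℝ)} {D : Set (Measure S)} {θ₀ θ : ℝ} {I : Finset ι} {ρ : ι → Measure S}
  {g : ι → S → ℝ}

theorem card_le_dimDE (hθ₀ : θ₀ ≤ θ) (hθ : 0 ≤ θ) (hρ : ∀ i ∈ I, ρ i ∈ D)
    (hg : ∀ i ∈ I, g i ∈ 𝒢) (hlt : ∀ i ∈ I, θ < |∫ s, g i s ∂ρ i|)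
    (hdep : ∀ i ∈ I, ∑ j ∈ I with j < i, (∫ s, g i s ∂ρ j) ^ 2 ≤ θ ^ 2) :
    (I.card : ℕ∞) ≤ dimDE 𝒢 D θ₀ := by
  let e := I.orderEmbOfFin rfl
  have he (i) : e i ∈ I := Finset.orderEmbOfFin_mem I rfl i
  refine le_iSup₂_of_le (f := fun (n : ℕ) _ => (n : ℕ∞)) I.card
    ⟨fun i => ρ (e i), fun i => hρ _ (he i), θ, hθ₀, fun i =>
      ⟨g (e i), hg _ (he i), (Real.sqrt_le_left hθ).2 (le_trans ?_ (hdep _ (he i))),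
        hlt _ (he i)⟩⟩ le_rfl
  have hinj : Function.Injective fun j : Fin i => e (Fin.castLE i.isLt.le j) :=
    e.injective.comp (Fin.castLE_injective _)
  rw [← Finset.sum_image (f := fun j => (∫ s, g (e i) s ∂ρ j) ^ 2)
    (g := fun j : Fin i => e (Fin.castLE i.isLt.le j)) hinj.injOn]
  refine Finset.sum_le_sum_of_subset_of_nonneg (fun j hj => ?_) fun _ _ _ => sq_nonneg _
  obtain ⟨k, _, rfl⟩ := Finset.mem_image.1 hj
  exact Finset.mem_filter.2 ⟨he _, e.strictMono (Fin.lt_def.2 k.isLt)⟩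

-- Each colour class of `exists_coloring` is a sequence admissible in the Eluder dimension.
theorem card_le_mul_dimDE {B : ℝ} {n : ℕ} (hθ₀ : θ₀ ≤ θ) (hθ : 0 ≤ θ) (hρ : ∀ i ∈ I, ρ i ∈ D)
    (hg : ∀ i ∈ I, g i ∈ 𝒢) (hlt : ∀ i ∈ I, θ < |∫ s, g i s ∂ρ i|)
    (hB : ∀ i ∈ I, ∑ j ∈ I with j < i, (∫ s, g i s ∂ρ j) ^ 2 ≤ B) (hn : B < n * θ ^ 2) :
    (I.card : ℕ∞) ≤ n * dimDE 𝒢 D θ₀ := by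
  obtain ⟨col, hcol, hsum⟩ := exists_coloring I (fun i j => (∫ s, g i s ∂ρ j) ^ 2) hB hn
  have card_color_le (c : ℕ) : ((I.filter fun i => col i = c).card : ℕ∞) ≤ dimDE 𝒢 D θ₀ := by
    have mem_of_color {i} (hi : i ∈ I.filter fun i => col i = c) : i ∈ I :=
      (Finset.mem_filter.1 hi).1
    refine card_le_dimDE hθ₀ hθ (fun i hi => hρ i (mem_of_color hi))
      (fun i hi => hg i (mem_of_color hi)) (fun i hi => hlt i (mem_of_color hi)) fun i hi => ?_
    obtain ⟨hiI, rfl⟩ := Finset.mem_filter.1 hi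
    simpa only [Finset.filter_filter, and_comm] using hsum i hiI
  calc (I.card : ℕ∞) = ∑ c ∈ Finset.range n, ((I.filter fun i => col i = c).card : ℕ∞) := by
        rw [Finset.card_eq_sum_card_fiberwise fun i hi =>
          Finset.mem_coe.2 (Finset.mem_range.2 (hcol i hi)), Nat.cast_sum]
    _ ≤ (Finset.range n).card • dimDE 𝒢 D θ₀ :=
        Finset.sum_le_card_nsmul _ _ _ fun c _ => card_color_le c
    _ = n * dimDE 𝒢 D θ₀ := by rw [Finset.card_range, nsmul_eq_mul]

end Eluder

section Peeling

theorem add_two_mul_sqrt_mul_le {r Q n : ℝ} (hn : 0 ≤ n) (hQ : (n + 1) * r ^ 2 ≤ Q) :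
    r + 2 * √(Q * n) ≤ 2 * √(Q * (n + 1)) := by
  have hQ0 : 0 ≤ Q := le_trans (by positivity) hQ
  have hr : √(n + 1) * r ≤ √Q := by
    refine Real.le_sqrt_of_sq_le ?_
    rwa [mul_pow, Real.sq_sqrt (by positivity)]
  have hpos : 0 < √(n + 1) := Real.sqrt_pos.2 (by positivity)
  have hdiff : √(n + 1) ^ 2 - √n ^ 2 = 1 := by
    rw [Real.sq_sqrt (by positivity), Real.sq_sqrt hn]
    ring
  have hsq : 0 ≤ √Q * (√(n + 1) - √n) ^ 2 := by positivity
  rw [Real.sqrt_mul hQ0, Real.sqrt_mul hQ0]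
  refine le_of_mul_le_mul_left ?_ hpos
  linear_combination hr + hsq - √Q * hdiff

theorem sum_le_two_mul_sqrt {ι : Type*} (S : Finset ι) {r : ι → ℝ} {Q : ℝ}
    (hQ : ∀ i ∈ S, ((S.filter fun j => r i ≤ r j).card : ℝ) * r i ^ 2 ≤ Q) :
    ∑ i ∈ S, r i ≤ 2 * √(Q * S.card) := by
  classical
  induction hn : S.card generalizing S with
  | zero => simp [Finset.card_eq_zero.1 hn]
  | succ n ih =>
    obtain ⟨i, hi, hmin⟩ := S.exists_min_image r (Finset.card_pos.1 (by omega))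
    have hQi := hQ i hi
    rw [Finset.filter_true_of_mem hmin, hn, Nat.cast_succ] at hQi
    have hQ_erase (j) (hj : j ∈ S.erase i) :
        (((S.erase i).filter fun k => r j ≤ r k).card : ℝ) * r j ^ 2 ≤ Q := by
      refine le_trans ?_ (hQ j (Finset.mem_of_mem_erase hj))
      gcongr
      exact Finset.erase_subset i S
    have hsum := ih (S.erase i) hQ_erase (by rw [Finset.card_erase_of_mem hi, hn]; rfl)
    rw [← Finset.add_sum_erase S r hi, Nat.cast_succ]
    exact (add_le_add le_rfl hsum).trans (add_two_mul_sqrt_mul_le n.cast_nonneg hQi)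

theorem sum_range_le_one_add_two_mul_sqrt {r : ℕ → ℝ} {T : ℕ} {Q : ℝ} (hQ0 : 0 ≤ Q)
    (hQ : ∀ t < T, 1 / (T : ℝ) ≤ r t →
      (((Finset.range T).filter fun s => r t ≤ r s).card : ℝ) * r t ^ 2 ≤ Q) :
    ∑ t ∈ Finset.range T, r t ≤ 1 + 2 * √(Q * T) := by
  have hsmall : ∑ t ∈ Finset.range T with ¬ 1 / (T : ℝ) ≤ r t, r t ≤ 1 := by
    calc ∑ t ∈ Finset.range T with ¬ 1 / (T : ℝ) ≤ r t, r t
        ≤ ∑ t ∈ Finset.range T with ¬ 1 / (T : ℝ) ≤ r t, 1 / (T : ℝ) :=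
          Finset.sum_le_sum fun t ht => (not_le.1 (Finset.mem_filter.1 ht).2).le
      _ ≤ ∑ t ∈ Finset.range T, 1 / (T : ℝ) :=
          Finset.sum_le_sum_of_subset_of_nonneg (Finset.filter_subset _ _) fun _ _ _ => by
            positivity
      _ ≤ 1 := by
          rw [Finset.sum_const, Finset.card_range, nsmul_eq_mul, mul_one_div]
          exact div_self_le_one _
  have hlarge : ∑ t ∈ Finset.range T with 1 / (T : ℝ) ≤ r t, r t ≤ 2 * √(Q * T) := by
    refine (sum_le_two_mul_sqrt _ (Q := Q) fun t ht => ?_).trans ?_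
    · obtain ⟨htT, ht1⟩ := Finset.mem_filter.1 ht
      refine le_trans ?_ (hQ t (Finset.mem_range.1 htT) ht1)
      gcongr
      exact Finset.filter_subset _ _
    · gcongr
      exact (Finset.card_filter_le _ _).trans_eq (Finset.card_range T)
  rw [← Finset.sum_filter_add_sum_filter_not _ fun t => 1 / (T : ℝ) ≤ r t]
  linarith

theorem mul_sq_le_of_lt_inv_sqrt {T q l H β : ℝ} (hT : 0 < T) (hq : 0 < q) (hl : 0 ≤ l)
    (hH : 0 < H) (hβ : 1 ≤ β) (hlt : q * l / (4 * H) < 1 / √T) :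
    T * l ^ 2 ≤ 32 * β * H ^ 2 / q ^ 2 := by
  have hsq : (q * l / (4 * H)) ^ 2 < 1 / T := by
    simpa only [div_pow (1 : ℝ), one_pow, Real.sq_sqrt hT.le]
      using pow_lt_pow_left₀ hlt (by positivity) two_ne_zero
  rw [div_pow, div_lt_div_iff₀ (by positivity) hT] at hsq
  rw [le_div_iff₀ (by positivity)]
  nlinarith [sq_nonneg H]

end Peeling

section Counting

variable {M : MDP X A} {F : FnClass M}

namespace FnClass

theorem sq_integral_residual_le (hF : F.Complete) {f : ValueFn X A} (hf : f ∈ F.fns) {h : ℕ}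
    (hh : h < M.H) (ν : Measure (X × A)) [IsProbabilityMeasure ν] :
    (∫ p, M.residual h f p ∂ν) ^ 2 ≤ ∫ p, M.residual h f p ^ 2 ∂ν := by
  have hmem : MemLp (M.residual h f) 2 ν :=
    .of_bound (F.measurable_residual hF hf hh).aestronglyMeasurable 1
      (.of_forall fun p => F.abs_residual_le_one hF hf hh p)
  exact sub_nonneg.1 <| (variance_nonneg _ _).trans_eq (variance_eq_sub hmem)

/-- `π` is dominated by `π₀` with constant `c`: no mean squared Bellman residual of the class is
more than `c` times larger under `π` than under `π₀`. This is the constraint on the comparison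
policies in the myopic exploration gap. -/
def IsDominated (F : FnClass M) (c : ℝ) (π π₀ : Policy X A) : Prop :=
  ∀ f ∈ F.fns, ∀ h : Fin M.H,
    ∫ p, M.residual h f p ^ 2 ∂M.occ π h ≤ c * ∫ p, M.residual h f p ^ 2 ∂M.occ π₀ h

theorem IsDominated.mono {c c' : ℝ} {π π₀ : Policy X A} (hdom : F.IsDominated c π π₀)
    (hc : c ≤ c') : F.IsDominated c' π π₀ := fun f hf h =>
  (hdom f hf h).trans <| mul_le_mul_of_nonneg_right hc <| integral_nonneg fun _ => sq_nonneg _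

theorem card_le_mul_dimBE (hF : F.Complete) {expl : ValueFn X A → Policy X A}
    {f : ℕ → ValueFn X A} {T : ℕ} {β : ℝ} (hconf : F.WithinConfidence expl f T β)
    {Pi' : Set (Policy X A)} {I : Finset ℕ} (hI : ∀ t ∈ I, t < T) {h : Fin M.H}
    {c θ₀ θ : ℝ} {n : ℕ}
    (hdom : ∀ t ∈ I, ∃ π ∈ Pi', F.IsDominated c π (expl (f t)) ∧
      θ < |∫ p, M.residual h (f t) p ∂M.occ π h|)
    (hc : 0 ≤ c) (hθ₀ : θ₀ ≤ θ) (hθ : 0 ≤ θ) (hn : c * β < n * θ ^ 2) :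
    (I.card : ℕ∞) ≤ n * dimBE F Pi' θ₀ := by
  have hdom' : ∀ t ∈ I, ∃ ρ ∈ (fun π => M.occ π h) '' Pi',
      (∀ g ∈ F.fns, (∫ p, M.residual h g p ∂ρ) ^ 2
        ≤ c * ∫ p, M.residual h g p ^ 2 ∂M.occ (expl (f t)) h) ∧
      θ < |∫ p, M.residual h (f t) p ∂ρ| := fun t ht => by
    obtain ⟨π, hπ, hπ_dom, hlt⟩ := hdom t ht
    exact ⟨_, ⟨π, hπ, rfl⟩, fun g hg =>
      (F.sq_integral_residual_le hF hg h.2 _).trans (hπ_dom g hg h), hlt⟩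
  choose! ρ hρ hρ_dom hlt using hdom'
  have hmem (t) (ht : t ∈ I) : f t ∈ F.fns := (hconf t (hI t ht)).1
  have hpast (t) (ht : t ∈ I) :
      ∑ s ∈ I with s < t, (∫ p, M.residual h (f t) p ∂ρ s) ^ 2 ≤ c * β := by
    have hnonneg (s) : 0 ≤ c * ∫ p, M.residual h (f t) p ^ 2 ∂M.occ (expl (f s)) h :=
      mul_nonneg hc (integral_nonneg fun _ => sq_nonneg _)
    calc ∑ s ∈ I with s < t, (∫ p, M.residual h (f t) p ∂ρ s) ^ 2
        ≤ ∑ s ∈ I with s < t, c * ∫ p, M.residual h (f t) p ^ 2 ∂M.occ (expl (f s)) h :=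
          Finset.sum_le_sum fun s hs => hρ_dom s (Finset.mem_filter.1 hs).1 _ (hmem t ht)
      _ ≤ ∑ s ∈ Finset.range t, c * ∫ p, M.residual h (f t) p ^ 2 ∂M.occ (expl (f s)) h :=
          Finset.sum_le_sum_of_subset_of_nonneg
            (fun s hs => Finset.mem_range.2 (Finset.mem_filter.1 hs).2) fun s _ _ => hnonneg s
      _ ≤ c * β := by
          rw [← Finset.mul_sum]
          exact mul_le_mul_of_nonneg_left ((hconf t (hI t ht)).2 h) hc
  refine (card_le_mul_dimDE (𝒢 := M.residual h '' F.fns) hθ₀ hθ hρ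
    (fun t ht => ⟨f t, hmem t ht, rfl⟩) hlt hpast hn).trans ?_
  gcongr
  exact le_iSup (fun h : Fin M.H => dimDE (M.residual h '' F.fns)
    ((fun π => M.occ π h) '' Pi') θ₀) h

theorem card_le_of_isDominated (hF : F.Complete) {expl : ValueFn X A → Policy X A}
    {f : ℕ → ValueFn X A} {T : ℕ} {β : ℝ} (hconf : F.WithinConfidence expl f T β)
    {Pi' : Set (Policy X A)} {I : Finset ℕ} (hI : ∀ t ∈ I, t < T) {h : Fin M.H} {c η θ₀ : ℝ}
    (hc : 1 ≤ c) (hη : 0 < η) (hθ₀ : θ₀ ≤ η) {d : ℕ} (hd : dimBE F Pi' θ₀ = d)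
    (hdom : ∀ t ∈ I, ∃ π ∈ Pi', F.IsDominated (2 * c) π (expl (f t)) ∧
      √c * η < |∫ p, M.residual h (f t) p ∂M.occ π h|) :
    I.card ≤ (⌊2 * β / η ^ 2⌋₊ + 1) * d := by
  have hc0 : 0 < c := zero_lt_one.trans_le hc
  have hfloor : 2 * β < ((⌊2 * β / η ^ 2⌋₊ + 1 : ℕ) : ℝ) * η ^ 2 := by
    rw [← div_lt_iff₀ (by positivity)]
    push_cast
    exact Nat.lt_floor_add_one _
  have hn : 2 * c * β < ((⌊2 * β / η ^ 2⌋₊ + 1 : ℕ) : ℝ) * (√c * η) ^ 2 := by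
    rw [mul_pow, Real.sq_sqrt hc0.le]
    linear_combination c * hfloor
  have hcard := F.card_le_mul_dimBE hF hconf hI hdom (by positivity)
    (hθ₀.trans <| le_mul_of_one_le_left hη.le <| Real.one_le_sqrt.2 hc) (by positivity) hn
  rwa [hd, ← Nat.cast_mul, Nat.cast_le] at hcard

end FnClass

namespace Greedy

variable {expl : ValueFn X A → Policy X A}

theorem exists_isDominated_of_lt_gap (G : Greedy F) {Pi' : Set (Policy X A)} {f : ValueFn X A}
    {γ : ℝ} (hγ : (γ : EReal) < gap G expl Pi' f) :
    ∃ c : ℝ, 1 ≤ c ∧ ∃ π' ∈ Pi', F.IsDominated c π' (expl f) ∧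
      F.IsDominated c (G.policy f) (expl f) ∧ √c * γ < M.ret π' - M.ret (G.policy f) := by
  unfold gap at hγ
  simp only [lt_iSup_iff, EReal.coe_lt_coe_iff] at hγ
  obtain ⟨π', hπ', c, hc, hdom, hlt⟩ := hγ
  rw [one_div, lt_inv_mul_iff₀ (Real.sqrt_pos.2 (zero_lt_one.trans_le hc))] at hlt
  exact ⟨c, hc, π', hπ', fun g hg h => (hdom g hg h).1, fun g hg h => (hdom g hg h).2, hlt⟩

theorem exists_lt_abs_integral_residual [Countable A] [MeasurableSingletonClass A]
    (hM : M.RewardBounded) (G : Greedy F) {f : ValueFn X A} (hf : f ∈ F.fns) {π' : Policy X A}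
    {b : ℝ} (hb : 0 ≤ b) (hlt : b < M.ret π' - M.ret (G.policy f)) :
    ∃ h : Fin M.H, ∃ π, (π = π' ∨ π = G.policy f) ∧
      b / (2 * M.H) < |∫ p, M.residual h f p ∂M.occ π h| := by
  by_contra! hsmall
  refine (hlt.trans_le (G.ret_sub_ret_le hM hf π')).not_ge ?_
  calc ∑ h : Fin M.H, (∫ p, M.residual h f p ∂M.occ (G.policy f) h
        - ∫ p, M.residual h f p ∂M.occ π' h)
      ≤ ∑ _h : Fin M.H, b / M.H := Finset.sum_le_sum fun h _ => by
        have hgreedy := (abs_le.1 (hsmall h _ (.inr rfl))).2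
        have hother := (abs_le.1 (hsmall h _ (.inl rfl))).1
        have hhalf : b / M.H = b / (2 * M.H) + b / (2 * M.H) := by
          rw [mul_comm, ← div_div, add_halves]
        linarith
    _ = M.H * (b / M.H) := by
        rw [Finset.sum_const, Finset.card_univ, Fintype.card_fin, nsmul_eq_mul]
    _ ≤ b := by
        rw [mul_div_left_comm]
        exact mul_le_of_le_one_right hb (div_self_le_one _)

-- Rounding the constant of the gap to a power of two leaves finitely many scales `j` to count over.
theorem exists_large_residual [Countable A] [MeasurableSingletonClass A]
    (hM : M.RewardBounded) (G : Greedy F) {f : ValueFn X A} (hf : f ∈ F.fns) {γ : ℝ} (hγ : 0 < γ)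
    (hgap : (γ : EReal) < gap G expl G.policies f) {J : ℕ} (hJ : 1 / γ ^ 2 ≤ 2 ^ J) :
    ∃ h : Fin M.H, ∃ j < J, ∃ π ∈ G.policies, F.IsDominated (2 ^ (j + 1)) π (expl f) ∧
      √(2 ^ j) * (γ / (2 * M.H)) < |∫ p, M.residual h f p ∂M.occ π h| := by
  obtain ⟨c, hc, π', hπ', hdom', hdom, hlt⟩ := G.exists_isDominated_of_lt_gap hgap
  obtain ⟨j, hjc, hcj⟩ := exists_nat_pow_near hc one_lt_two
  have hcγ : √c * γ < 1 := by linarith [hM.ret_le_one π', hM.ret_nonneg (G.policy f)]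
  have hcJ : c < 2 ^ J := by
    refine lt_of_lt_of_le ?_ hJ
    have hsq : (√c * γ) ^ 2 < 1 := pow_lt_one₀ (by positivity) hcγ two_ne_zero
    rwa [mul_pow, Real.sq_sqrt (by linarith), ← lt_div_iff₀ (by positivity)] at hsq
  obtain ⟨h, π, hπ, hlarge⟩ := G.exists_lt_abs_integral_residual hM hf (by positivity) hlt
  refine ⟨h, j, (pow_lt_pow_iff_right₀ one_lt_two).1 (hjc.trans_lt hcJ), π, ?_, ?_, ?_⟩
  · rcases hπ with rfl | rfl
    exacts [hπ', ⟨f, hf, rfl⟩]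
  · rcases hπ with rfl | rfl
    exacts [hdom'.mono hcj.le, hdom.mono hcj.le]
  · refine lt_of_le_of_lt ?_ hlarge
    rw [mul_div_assoc]
    gcongr

theorem card_le_of_lt_gap [Countable A] [MeasurableSingletonClass A]
    (hM : M.RewardBounded) (hF : F.Complete) (G : Greedy F) {f : ℕ → ValueFn X A} {T : ℕ} {β : ℝ}
    (hβ : 0 ≤ β) (hconf : F.WithinConfidence expl f T β) {γ θ₀ : ℝ} (hγ : 0 < γ)
    (hθ₀ : θ₀ ≤ γ / (2 * M.H)) {d : ℕ} (hd : dimBE F G.policies θ₀ = d)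
    {J : ℕ} (hJ : 1 / γ ^ 2 ≤ 2 ^ J) {I : Finset ℕ} (hI : ∀ t ∈ I, t < T)
    (hgap : ∀ t ∈ I, (γ : EReal) < gap G expl G.policies (f t)) :
    (I.card : ℝ) ≤ (2 * β / (γ / (2 * M.H)) ^ 2 + 1) * d * (M.H * J) := by
  classical
  set η := γ / (2 * M.H)
  set n := ⌊2 * β / η ^ 2⌋₊ + 1 with hn
  let detected (h : Fin M.H) (j : ℕ) : Finset ℕ := I.filter fun t =>
    ∃ π ∈ G.policies, F.IsDominated (2 ^ (j + 1)) π (expl (f t)) ∧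
      √(2 ^ j) * η < |∫ p, M.residual h (f t) p ∂M.occ π h|
  have card_detected_le (h : Fin M.H) (j : ℕ) : (detected h j).card ≤ n * d := by
    have hη : 0 < η := div_pos hγ (mul_pos two_pos (Nat.cast_pos.2 (Fin.pos h)))
    refine F.card_le_of_isDominated hF hconf (fun t ht => hI t (Finset.mem_filter.1 ht).1)
      (one_le_pow₀ one_le_two) hη hθ₀ hd (h := h) (c := 2 ^ j) fun t ht => ?_
    rw [← pow_succ']
    exact (Finset.mem_filter.1 ht).2
  have hcover : I ⊆ (Finset.univ ×ˢ Finset.range J).biUnion fun hj => detected hj.1 hj.2 :=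
    fun t ht => by
      obtain ⟨h, j, hj, hlarge⟩ :=
        G.exists_large_residual hM (hconf t (hI t ht)).1 hγ (hgap t ht) hJ
      exact Finset.mem_biUnion.2 ⟨(h, j), by simpa using hj, Finset.mem_filter.2 ⟨ht, hlarge⟩⟩
  have hcard : I.card ≤ M.H * J * (n * d) := by
    simpa only [Finset.card_product, Finset.card_univ, Fintype.card_fin, Finset.card_range] using
      (Finset.card_le_card hcover).trans
        (Finset.card_biUnion_le_card_mul _ _ _ fun hj _ => card_detected_le hj.1 hj.2)
  calc (I.card : ℝ) ≤ ((M.H * J * (n * d) : ℕ) : ℝ) := Nat.cast_le.2 hcard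
    _ = n * d * (M.H * J) := by push_cast; ring
    _ ≤ (2 * β / η ^ 2 + 1) * d * (M.H * J) := by
        gcongr
        rw [hn, Nat.cast_succ]
        gcongr
        exact Nat.floor_le (by positivity)

theorem card_suboptimal_mul_sq_le [Countable A] [MeasurableSingletonClass A]
    (hM : M.RewardBounded) (hF : F.Complete) (G : Greedy F) {f : ℕ → ValueFn X A} {T : ℕ}
    (hT : 0 < T) {β : ℝ} (hβ : 0 ≤ β) (hconf : F.WithinConfidence expl f T β) {q l θ₀ : ℝ}
    (hq : 0 < q) (hl : 1 / (T : ℝ) ≤ l) (hl1 : l ≤ 1)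
    (hgap : ((q * l : ℝ) : EReal) ≤ gapOn G expl (G.suboptimal l))
    (hθ₀ : θ₀ ≤ q * l / (4 * M.H)) {d : ℕ} (hd : dimBE F G.policies θ₀ = d) {J : ℕ}
    (hJ : 4 * (T : ℝ) ^ 2 / q ^ 2 ≤ 2 ^ J) :
    (((Finset.range T).filter fun t => l ≤ M.optRet - M.ret (G.policy (f t))).card : ℝ) * l ^ 2
      ≤ (32 * β * M.H ^ 2 / q ^ 2 + 1) * d * (M.H * J) := by
  have hTR : (0 : ℝ) < T := Nat.cast_pos.2 hT
  have hl0 : 0 < l := (one_div_pos.2 hTR).trans_le hl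
  set I := (Finset.range T).filter fun t => l ≤ M.optRet - M.ret (G.policy (f t))
  have hI (t) (ht : t ∈ I) : t < T := Finset.mem_range.1 (Finset.mem_filter.1 ht).1
  have hgap' (t) (ht : t ∈ I) : ((q * l / 2 : ℝ) : EReal) < gap G expl G.policies (f t) :=
    (EReal.coe_lt_coe_iff.2 (half_lt_self (mul_pos hq hl0))).trans_le <|
      hgap.trans <| iInf₂_le (f t) ⟨(hconf t (hI t ht)).1, (Finset.mem_filter.1 ht).2⟩
  have hJ' : 1 / (q * l / 2) ^ 2 ≤ 2 ^ J := by
    refine le_trans ?_ hJ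
    calc 1 / (q * l / 2) ^ 2 = 4 * (1 / l) ^ 2 / q ^ 2 := by field_simp; norm_num
      _ ≤ 4 * (T : ℝ) ^ 2 / q ^ 2 := by
        gcongr
        exact (one_div_le hTR hl0).1 hl
  have hcard := G.card_le_of_lt_gap hM hF hβ hconf (half_pos (mul_pos hq hl0))
    (hθ₀.trans_eq (by ring)) hd hJ' hI hgap'
  calc (I.card : ℝ) * l ^ 2
      ≤ (2 * β / (q * l / 2 / (2 * M.H)) ^ 2 + 1) * d * (M.H * J) * l ^ 2 := by gcongr
    _ = (32 * β * M.H ^ 2 / q ^ 2 + l ^ 2) * d * (M.H * J) := by field_simp; ring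
    _ ≤ (32 * β * M.H ^ 2 / q ^ 2 + 1) * d * (M.H * J) := by
        gcongr
        exact pow_le_one₀ hl0.le hl1

theorem sum_suboptimality_le [Countable A] [MeasurableSingletonClass A]
    (hM : M.RewardBounded) (hF : F.Complete) (G : Greedy F) (hH : 0 < M.H)
    {f : ℕ → ValueFn X A} {T : ℕ} {β : ℝ} (hβ : 1 ≤ β) (hconf : F.WithinConfidence expl f T β)
    {q : ℝ} (hq : 0 < q)
    (hgap : ∀ l ∈ Set.Icc (0 : ℝ) 1, ((q * l : ℝ) : EReal) ≤ gapOn G expl (G.suboptimal l))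
    {d : ℕ} (hd : dimBE F G.policies (1 / √(T : ℝ)) = d) {J : ℕ} (hJ1 : 1 ≤ J)
    (hJ : 4 * (T : ℝ) ^ 2 / q ^ 2 ≤ 2 ^ J) :
    ∑ t ∈ Finset.range T, (M.optRet - M.ret (G.policy (f t)))
      ≤ 1 + 2 * √((32 * β * M.H ^ 2 / q ^ 2 + 1) * max 1 (d : ℝ) * (M.H * J) * T) := by
  have hHJ : (1 : ℝ) ≤ M.H * J := by exact_mod_cast Nat.mul_pos hH hJ1
  refine sum_range_le_one_add_two_mul_sqrt (by positivity) fun t ht hl => ?_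
  have hT : 0 < T := (Nat.zero_le t).trans_lt ht
  have hTR : (0 : ℝ) < T := Nat.cast_pos.2 hT
  set l := M.optRet - M.ret (G.policy (f t))
  have hl0 : 0 ≤ l := (one_div_nonneg.2 hTR.le).trans hl
  have hl1 : l ≤ 1 := by
    linarith [hM.optRet_le_one, hM.ret_nonneg (G.policy (f t))]
  rcases le_or_gt (1 / √(T : ℝ)) (q * l / (4 * M.H)) with hscale | hscale
  · refine (G.card_suboptimal_mul_sq_le hM hF hT (by linarith) hconf hq hl hl1 (hgap l ⟨hl0, hl1⟩)
      hscale hd hJ).trans ?_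
    gcongr
    exact le_max_right _ _
  · calc _ ≤ T * l ^ 2 := by
          gcongr
          exact (Finset.card_filter_le _ _).trans_eq (Finset.card_range T)
      _ ≤ (32 * β * M.H ^ 2 / q ^ 2 + 1) * 1 * 1 := by
          rw [mul_one, mul_one]
          exact (mul_sq_le_of_lt_inv_sqrt hTR hq hl0 (Nat.cast_pos.2 hH) hβ hscale).trans
            (le_add_of_nonneg_right zero_le_one)
      _ ≤ (32 * β * M.H ^ 2 / q ^ 2 + 1) * max 1 (d : ℝ) * (M.H * J) := by
          gcongr
          exact le_max_left _ _

end Greedy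

end Counting

section Rates

theorem sq_mul_rpow_half {c x h : ℝ} (hx : 0 ≤ x) : (c * x ^ (h / 2)) ^ 2 = c ^ 2 * x ^ h := by
  rw [mul_pow, ← Real.rpow_mul_natCast hx, Nat.cast_ofNat, div_mul_cancel₀ _ two_ne_zero]

theorem log_mul_sq_div_le {T N δ a : ℝ} (hT : 1 ≤ T) (hN : 1 ≤ N) (hδ : 0 < δ) (hδ1 : δ ≤ 1)
    (ha : 1 ≤ a) :
    Real.log (T * N ^ 2 / δ) ≤ 3 * ((1 + Real.log (a * T)) * max 1 (Real.log (N / δ))) := by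
  have hlog : Real.log (T * N ^ 2 / δ) = Real.log T + 2 * Real.log N - Real.log δ := by
    rw [Real.log_div (by positivity) hδ.ne', Real.log_mul (by positivity) (by positivity),
      Real.log_pow, Nat.cast_ofNat]
  have hlogN : Real.log (N / δ) = Real.log N - Real.log δ := Real.log_div (by positivity) hδ.ne'
  have hlogT : Real.log T ≤ Real.log (a * T) :=
    Real.log_le_log (by positivity) (le_mul_of_one_le_left (by positivity) ha)
  have hlogT0 := Real.log_nonneg hT
  have hlogδ := Real.log_nonpos hδ.le hδ1
  have hK1 := le_max_left 1 (Real.log (N / δ))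
  have hK := le_max_right 1 (Real.log (N / δ))
  nlinarith [mul_nonneg (hlogT0.trans hlogT) (sub_nonneg.2 hK1)]

theorem radius_mem_Icc {T N δ a : ℝ} (hT : 1 ≤ T) (hN : 1 ≤ N) (hδ : 0 < δ) (hδ1 : δ ≤ 1)
    (ha : 1 ≤ a) :
    36 + 64 * Real.log (T * N ^ 2 / δ)
      ∈ Set.Icc 1 (228 * ((1 + Real.log (a * T)) * max 1 (Real.log (N / δ)))) := by
  have hTN : 1 ≤ T * N ^ 2 / δ := (one_le_div hδ).2
    (hδ1.trans (one_le_mul_of_one_le_of_one_le hT (one_le_pow₀ hN)))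
  have hLK : 1 ≤ (1 + Real.log (a * T)) * max 1 (Real.log (N / δ)) :=
    one_le_mul_of_one_le_of_one_le (le_add_of_nonneg_right
      (Real.log_nonneg (one_le_mul_of_one_le_of_one_le ha hT))) (le_max_left _ _)
  have hlog := log_mul_sq_div_le hT hN hδ hδ1 ha
  constructor <;> linarith [Real.log_nonneg hTN]

theorem exists_le_two_pow {x c : ℝ} (hx : 0 < x) (hc : 0 ≤ c) (hxc : Real.log x ≤ c) :
    ∃ J : ℕ, 1 ≤ J ∧ x ≤ 2 ^ J ∧ (J : ℝ) ≤ 2 * c + 1 := by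
  refine ⟨⌊Real.logb 2 x⌋₊ + 1, by omega, ?_, ?_⟩
  · have hle := (Nat.lt_floor_add_one (Real.logb 2 x)).le
    rw [Real.logb_le_iff_le_rpow one_lt_two hx] at hle
    exact_mod_cast hle
  · have hlogb : Real.logb 2 x ≤ 2 * c := by
      rw [Real.logb, div_le_iff₀ (Real.log_pos one_lt_two)]
      nlinarith [Real.log_two_gt_d9]
    push_cast
    gcongr
    exact (Nat.cast_le.2 (Nat.floor_le_floor hlogb)).trans (Nat.floor_le (by positivity))

theorem log_scales_le {κ ε a T h L : ℝ} (hκ : 0 < κ) (hT : 1 ≤ T) (hε : 1 / T ≤ ε) (ha : 1 ≤ a)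
    (hh : 1 ≤ h) (hL : 1 + Real.log (a * T) ≤ L) :
    Real.log (4 * T ^ 2 / (κ * (ε / a) ^ (h / 2)) ^ 2)
      ≤ (|Real.log (4 / κ ^ 2)| + 3) * (h * L) := by
  have hε0 : 0 < ε := lt_of_lt_of_le (by positivity) hε
  have hlog : Real.log (4 * T ^ 2 / (κ * (ε / a) ^ (h / 2)) ^ 2)
      = Real.log (4 / κ ^ 2) + 2 * Real.log T + h * (Real.log a - Real.log ε) := by
    rw [sq_mul_rpow_half (by positivity), mul_div_mul_comm, Real.log_mul (by positivity)
      (by positivity), Real.log_div (x := T ^ 2) (by positivity) (by positivity), Real.log_pow,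
      Real.log_rpow (by positivity), Real.log_div hε0.ne' (by positivity)]
    push_cast
    ring
  have hlogε : -Real.log ε ≤ Real.log T := by
    have hle := Real.log_le_log (by positivity) hε
    rw [one_div, Real.log_inv] at hle
    linarith
  rw [Real.log_mul (by positivity) (by positivity)] at hL
  have hloga := Real.log_nonneg ha
  have hlogT := Real.log_nonneg hT
  have hL1 : 1 ≤ L := by linarith
  have hhL : 1 ≤ h * L := one_le_mul_of_one_le_of_one_le hh hL1
  have hκL : Real.log (4 / κ ^ 2) ≤ |Real.log (4 / κ ^ 2)| * (h * L) :=
    (le_abs_self _).trans (le_mul_of_one_le_right (abs_nonneg _) hhL)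
  have hTL : Real.log T ≤ h * L :=
    (by linarith : Real.log T ≤ L).trans (le_mul_of_one_le_left (by linarith) hh)
  have hεL : h * (Real.log a - Real.log ε) ≤ h * L :=
    mul_le_mul_of_nonneg_left (by linarith) (by linarith)
  rw [hlog]
  linarith

theorem exists_scales {κ ε a T h L : ℝ} (hκ : 0 < κ) (hT : 1 ≤ T) (hε : 1 / T ≤ ε) (ha : 1 ≤ a)
    (hh : 1 ≤ h) (hL : 1 + Real.log (a * T) ≤ L) :
    ∃ J : ℕ, 1 ≤ J ∧ 4 * T ^ 2 / (κ * (ε / a) ^ (h / 2)) ^ 2 ≤ 2 ^ J ∧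
      (J : ℝ) ≤ (2 * |Real.log (4 / κ ^ 2)| + 7) * (h * L) := by
  have hε0 : 0 < ε := lt_of_lt_of_le (by positivity) hε
  have hL1 : 1 ≤ L :=
    (le_add_of_nonneg_right (Real.log_nonneg (one_le_mul_of_one_le_of_one_le ha hT))).trans hL
  have hhL : 1 ≤ h * L := one_le_mul_of_one_le_of_one_le hh hL1
  obtain ⟨J, hJ1, hJ, hJle⟩ := exists_le_two_pow (by positivity) (by positivity)
    (log_scales_le hκ hT hε ha hh hL)
  exact ⟨J, hJ1, hJ, by linarith⟩

/-- The constant of the regret bounds. The factors under the root come from the confidence radius,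
the number of dyadic scales and the Bellman residuals that the gap forces to be large. -/
def regretConst (κ : ℝ) : ℝ :=
  1 + 2 * √(228 * (2 * |Real.log (4 / κ ^ 2)| + 7) * (32 / κ ^ 2 + 1))

theorem one_le_regretConst (κ : ℝ) : 1 ≤ regretConst κ :=
  le_add_of_nonneg_right (by positivity)

theorem div_le_rate {ε T h Q H : ℝ} (hε0 : 0 < ε) (hε1 : ε ≤ 1) (hT : 0 ≤ T) (hh : 1 ≤ h)
    (hQ : 1 ≤ Q) (hH : 1 ≤ H) : T / ε ≤ Q * H ^ 3 * T / ε ^ h := by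
  have hεh : ε ^ h ≤ ε := by
    simpa only [Real.rpow_one] using Real.rpow_le_rpow_of_exponent_ge hε0 hε1 hh
  have hQH : 1 ≤ Q * H ^ 3 := one_le_mul_of_one_le_of_one_le hQ (one_le_pow₀ hH)
  calc T / ε ≤ T / ε ^ h := by gcongr
    _ ≤ Q * H ^ 3 * T / ε ^ h := by
        gcongr
        exact le_mul_of_one_le_left hT hQH

theorem le_sqrt_div {ε T : ℝ} (hε0 : 0 < ε) (hT : 0 < T) (hε : ε ≤ 1 / T) : T ≤ √(T / ε) := by
  refine Real.le_sqrt_of_sq_le ((le_div_iff₀ hε0).2 ?_)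
  calc T ^ 2 * ε ≤ T ^ 2 * (1 / T) := by gcongr
    _ = T := by field_simp

theorem radicand_le {κ ε a T h L D K H J β : ℝ} (hκ : 0 < κ) (hε0 : 0 < ε) (hε1 : ε ≤ 1)
    (hT : 0 ≤ T) (ha : 1 ≤ a) (hh : 0 ≤ h) (hD : 0 ≤ D) (hH : 1 ≤ H) (hβ : 1 ≤ β)
    (hβ' : β ≤ 228 * (L * K)) (hJ0 : 0 ≤ J)
    (hJ : J ≤ (2 * |Real.log (4 / κ ^ 2)| + 7) * (h * L)) :
    (32 * β * H ^ 2 / (κ * (ε / a) ^ (h / 2)) ^ 2 + 1) * D * (H * J) * T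
      ≤ 228 * (2 * |Real.log (4 / κ ^ 2)| + 7) * (32 / κ ^ 2 + 1)
        * (L ^ 2 * (h * a ^ h * D * K * H ^ 3 * T / ε ^ h)) := by
  set c := 2 * |Real.log (4 / κ ^ 2)| + 7
  set R := a ^ h / ε ^ h with hR
  have hεh : 0 < ε ^ h := by positivity
  have hR1 : 1 ≤ R :=
    (one_le_div hεh).2 ((Real.rpow_le_one hε0.le hε1 hh).trans (Real.one_le_rpow ha hh))
  have hgap_sq : (κ * (ε / a) ^ (h / 2)) ^ 2 = κ ^ 2 / R := by
    rw [sq_mul_rpow_half (by positivity), Real.div_rpow hε0.le (by positivity), hR]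
    field_simp
  have hβHR : 1 ≤ β * (H ^ 2 * R) := one_le_mul_of_one_le_of_one_le hβ
    (one_le_mul_of_one_le_of_one_le (one_le_pow₀ hH) hR1)
  have hresidual : 32 * β * H ^ 2 / (κ * (ε / a) ^ (h / 2)) ^ 2 + 1
      ≤ (32 / κ ^ 2 + 1) * (228 * (L * K)) * H ^ 2 * R := by
    calc 32 * β * H ^ 2 / (κ * (ε / a) ^ (h / 2)) ^ 2 + 1
        = 32 / κ ^ 2 * (β * (H ^ 2 * R)) + 1 := by rw [hgap_sq]; field_simp
      _ ≤ 32 / κ ^ 2 * (β * (H ^ 2 * R)) + β * (H ^ 2 * R) := by gcongr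
      _ = (32 / κ ^ 2 + 1) * β * H ^ 2 * R := by ring
      _ ≤ (32 / κ ^ 2 + 1) * (228 * (L * K)) * H ^ 2 * R := by gcongr
  have hresidual0 : 0 ≤ 32 * β * H ^ 2 / (κ * (ε / a) ^ (h / 2)) ^ 2 + 1 := by positivity
  calc _ ≤ (32 / κ ^ 2 + 1) * (228 * (L * K)) * H ^ 2 * R * D * (H * (c * (h * L))) * T := by
        gcongr
        exact mul_nonneg (hresidual0.trans hresidual) hD
    _ = _ := by rw [hR]; ring

theorem one_add_two_mul_sqrt_le {κ x L W : ℝ} (hL : 1 ≤ L) (hW : 1 ≤ W)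
    (hx : x ≤ 228 * (2 * |Real.log (4 / κ ^ 2)| + 7) * (32 / κ ^ 2 + 1) * (L ^ 2 * W)) :
    1 + 2 * √x ≤ regretConst κ * L * √W := by
  have hsqrt := Real.sqrt_le_sqrt hx
  rw [Real.sqrt_mul (by positivity), Real.sqrt_mul (sq_nonneg L), Real.sqrt_sq (by linarith)]
    at hsqrt
  have hLW : 1 ≤ L * √W := one_le_mul_of_one_le_of_one_le hL (Real.one_le_sqrt.2 hW)
  rw [regretConst]
  linarith

theorem rate_eq {T h H Q : ℝ} (hT : 0 < T) (hh : 0 ≤ h) (hH : 0 < H) (hQ : 0 ≤ Q) :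
    H ^ ((h + 3) / (h + 2)) * T ^ ((h + 1) / (h + 2)) * Q ^ (1 / (h + 2))
      = H * T * (H * Q / T) ^ (1 / (h + 2)) := by
  have hH_exp : (h + 3) / (h + 2) = 1 + 1 / (h + 2) := by field_simp; ring
  have hT_exp : (h + 1) / (h + 2) = 1 - 1 / (h + 2) := by field_simp; ring
  rw [hH_exp, hT_exp, Real.rpow_add hH, Real.rpow_sub hT, Real.rpow_one, Real.rpow_one,
    Real.div_rpow (by positivity) hT.le, Real.mul_rpow hH.le hQ]
  ring

-- `B` solves `B ^ (h + 2) = H Q / T`, which balances the two terms of the regret bound.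
theorem sqrt_rate_le {ε T h Q H B ρ : ℝ} (hT : 0 < T) (hh : 0 ≤ h) (hQ : 0 < Q) (hH : 0 < H)
    (hB : B = (H * Q / T) ^ (1 / (h + 2))) (hρ : 0 < ρ) (hε : B / ρ ≤ ε) :
    √(Q * H ^ 3 * T / ε ^ h) ≤ H * T * B * ρ ^ (h / 2) := by
  have hB0 : 0 < B := by rw [hB]; positivity
  have hBpow : B ^ h * B ^ 2 = H * Q / T := by
    rw [← Real.rpow_add_natCast hB0.ne', hB, ← Real.rpow_mul (by positivity), Nat.cast_ofNat,
      one_div_mul_cancel (by positivity), Real.rpow_one]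
  have hεh : B ^ h / ρ ^ h ≤ ε ^ h := by
    rw [← Real.div_rpow hB0.le hρ.le]
    exact Real.rpow_le_rpow (by positivity) hε hh
  refine Real.sqrt_le_iff.2 ⟨by positivity, ?_⟩
  calc Q * H ^ 3 * T / ε ^ h = H ^ 2 * T ^ 2 * (B ^ h * B ^ 2) / ε ^ h := by
        rw [hBpow]
        field_simp
    _ ≤ H ^ 2 * T ^ 2 * (B ^ h * B ^ 2) / (B ^ h / ρ ^ h) := by gcongr
    _ = (H * T * B) ^ 2 * ρ ^ h := by field_simp
    _ = (H * T * B * ρ ^ (h / 2)) ^ 2 := (sq_mul_rpow_half hρ.le).symm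

theorem le_rate_of_le {reg ε T h R Q H B ρ₁ ρ₂ : ℝ} (hT : 0 < T) (hh : 0 ≤ h) (hR : 1 ≤ R)
    (hQ : 0 < Q) (hH : 1 ≤ H) (hreg : reg ≤ ε * H * T + R * √(Q * H ^ 3 * T / ε ^ h))
    (hregT : reg ≤ T) (hB : B = (H * Q / T) ^ (1 / (h + 2))) (hρ₁ : 0 < ρ₁) (hρ₂ : 1 ≤ ρ₂)
    (hε₁ : min 1 B / ρ₁ ≤ ε) (hε₂ : ε ≤ ρ₂ * B) :
    reg ≤ R * (ρ₁ ^ (h / 2) + ρ₂)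
      * (H ^ ((h + 3) / (h + 2)) * T ^ ((h + 1) / (h + 2)) * Q ^ (1 / (h + 2))) := by
  have hH0 : 0 < H := by linarith
  have hB0 : 0 < B := by rw [hB]; positivity
  have hρh : 0 ≤ ρ₁ ^ (h / 2) := by positivity
  rw [rate_eq hT hh hH0 hQ.le, ← hB]
  rcases le_or_gt B 1 with hB1 | hB1
  · rw [min_eq_right hB1] at hε₁
    have hexplore : ε * H * T ≤ R * (H * T * B * ρ₂) := by
      calc ε * H * T ≤ ρ₂ * B * H * T := by gcongr
        _ = 1 * (H * T * B * ρ₂) := by ring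
        _ ≤ R * (H * T * B * ρ₂) := by gcongr
    calc reg ≤ R * (H * T * B * ρ₂) + R * (H * T * B * ρ₁ ^ (h / 2)) := by
          refine hreg.trans (add_le_add hexplore ?_)
          gcongr
          exact sqrt_rate_le hT hh hQ hH0 hB hρ₁ hε₁
      _ = R * (ρ₁ ^ (h / 2) + ρ₂) * (H * T * B) := by ring
  · calc reg ≤ 1 * (0 + 1) * (1 * T * 1) := by linarith
      _ ≤ R * (ρ₁ ^ (h / 2) + ρ₂) * (H * T * B) := by gcongr

end Rates

section Regret

variable {M : MDP X A} {F : FnClass M} [MeasurableSingletonClass A] {Ω : Type w}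
  [MeasurableSpace Ω] {μ : Measure Ω}

namespace Run

theorem regret_le [Countable A] (hM : M.RewardBounded) {expl : ValueFn X A → Policy X A}
    (run : Run F expl μ) (T : ℕ) (ω : Ω) : run.regret T ω ≤ T := by
  calc run.regret T ω ≤ ∑ _t ∈ Finset.range T, (1 : ℝ) := Finset.sum_le_sum fun t _ => by
        linarith [hM.optRet_le_one, hM.ret_nonneg (expl (run.fhat t ω))]
    _ = T := by simp

variable [Fintype A] [Nonempty A] {G : Greedy F} {ε : ℝ} {hε : ε ∈ Set.Icc (0 : ℝ) 1}

theorem regret_le_add_sum_suboptimality (hM : M.RewardBounded)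
    (run : Run F (G.explore ε hε) μ) (T : ℕ) (ω : Ω) :
    run.regret T ω ≤ ε * M.H * T
      + ∑ t ∈ Finset.range T, (M.optRet - M.ret (G.policy (run.fhat t ω))) := by
  have hexplore (t : ℕ) : M.optRet - M.ret (G.explore ε hε (run.fhat t ω))
      ≤ ε * M.H + (M.optRet - M.ret (G.policy (run.fhat t ω))) := by
    have hret := hM.ret_sub_le_ret_epsGreedy hε (G.measurable (run.fhat t ω))
    rw [Greedy.explore, Greedy.policy]
    linarith
  calc run.regret T ω
      ≤ ∑ t ∈ Finset.range T,
          (ε * M.H + (M.optRet - M.ret (G.policy (run.fhat t ω)))) :=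
        Finset.sum_le_sum fun t _ => hexplore t
    _ = _ := by
        rw [Finset.sum_add_distrib, Finset.sum_const, Finset.card_range, nsmul_eq_mul, mul_comm]

theorem regret_le_of_withinConfidence (hM : M.RewardBounded)
    (hF : F.Complete) (run : Run F (G.explore ε hε) μ) (hH : 0 < M.H) {T : ℕ} (hT : 1 ≤ T)
    (hε0 : 0 < ε) {κ h : ℝ} (hκ : 0 < κ) (hh : 1 ≤ h)
    (hgap : ∀ l ∈ Set.Icc (0 : ℝ) 1, ((κ * (ε / Fintype.card A) ^ (h / 2) * l : ℝ) : EReal)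
      ≤ gapOn G (G.explore ε hε) (G.suboptimal l))
    {d : ℕ} (hd : dimBE F G.policies (1 / √(T : ℝ)) = d) {L K β : ℝ}
    (hL : 1 + Real.log (Fintype.card A * T) ≤ L) (hK : 1 ≤ K) (hβ : 1 ≤ β)
    (hβ' : β ≤ 228 * (L * K)) {ω : Ω}
    (hconf : F.WithinConfidence (G.explore ε hε) (run.fhat · ω) T β) :
    run.regret T ω ≤ ε * M.H * T + regretConst κ * L
      * √(h * (Fintype.card A : ℝ) ^ h * max 1 (d : ℝ) * K * M.H ^ 3 * T / ε ^ h) := by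
  have hTR : (1 : ℝ) ≤ T := Nat.one_le_cast.2 hT
  have ha : (1 : ℝ) ≤ Fintype.card A := Nat.one_le_cast.2 Fintype.card_pos
  have hHR : (1 : ℝ) ≤ M.H := Nat.one_le_cast.2 hH
  have hL1 : 1 ≤ L :=
    (le_add_of_nonneg_right (Real.log_nonneg (one_le_mul_of_one_le_of_one_le ha hTR))).trans hL
  have hQ : 1 ≤ h * (Fintype.card A : ℝ) ^ h * max 1 (d : ℝ) * K :=
    one_le_mul_of_one_le_of_one_le (one_le_mul_of_one_le_of_one_le (one_le_mul_of_one_le_of_one_le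
      hh (Real.one_le_rpow ha (by linarith))) (le_max_left _ _)) hK
  have hrate := div_le_rate hε0 hε.2 (Nat.cast_nonneg T) hh hQ hHR
  rcases le_or_gt (1 / (T : ℝ)) ε with hεT | hεT
  · obtain ⟨J, hJ1, hJ, hJle⟩ := exists_scales hκ hTR hεT ha hh hL
    refine (run.regret_le_add_sum_suboptimality hM T ω).trans (add_le_add le_rfl ?_)
    have hsum := G.sum_suboptimality_le hM hF hH hβ hconf (by positivity) hgap hd hJ1 hJ
    refine hsum.trans (one_add_two_mul_sqrt_le hL1 ?_ ?_)
    · exact (hTR.trans (le_div_self (by positivity) hε0 hε.2)).trans hrate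
    · exact radicand_le hκ hε0 hε.2 (by positivity) ha (by linarith) (by positivity) hHR hβ hβ'
        (by positivity) hJle
  · calc run.regret T ω ≤ T := run.regret_le hM T ω
      _ ≤ √(T / ε) := le_sqrt_div hε0 (by linarith) hεT.le
      _ ≤ √(h * (Fintype.card A : ℝ) ^ h * max 1 (d : ℝ) * K * M.H ^ 3 * T / ε ^ h) :=
          Real.sqrt_le_sqrt hrate
      _ ≤ _ := le_add_of_nonneg_of_le (by positivity) (le_mul_of_one_le_left (Real.sqrt_nonneg _)
          (one_le_mul_of_one_le_of_one_le (one_le_regretConst κ) hL1))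

end Run

end Regret

end MyopicRL

end

theorem mainTheorem3 :
    ∃ p : ℕ, ∀ κ : ℝ, 0 < κ → ∃ C : ℝ, 0 < C ∧
      ∀ (X : Type u) [MeasurableSpace X]
        (A : Type v) [MeasurableSpace A] [MeasurableSingletonClass A] [Fintype A] [Nonempty A]
        (M : MyopicRL.MDP X A) (_ : M.RewardBounded)
        (F : MyopicRL.FnClass M) (_ : F.Complete) (G : MyopicRL.Greedy F)
        (T : ℕ) (_ : 1 ≤ T)
        (ε : ℝ) (_ : 0 < ε) (hε : ε ∈ Set.Icc (0 : ℝ) 1)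
        (Ω : Type w) [MeasurableSpace Ω] (μ : MeasureTheory.Measure Ω)
        [MeasureTheory.IsProbabilityMeasure μ]
        (run : MyopicRL.Run F (G.explore ε hε) μ)
        (h : ℝ) (_ : 1 ≤ h) (_ : h ≤ M.H)
        (_ : ∀ l ∈ Set.Icc (0 : ℝ) 1,
          ((κ * (ε / Fintype.card A) ^ (h / 2) * l : ℝ) : EReal)
            ≤ MyopicRL.gapOn G (G.explore ε hε) (G.suboptimal l))
        (d : ℕ) (_ : MyopicRL.dimBE F G.policies (1 / √(T : ℝ)) = d)
        (N : ℕ) (_ : F.coverSum (1 / (T : ℝ)) = N)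
        (δ : ℝ) (_ : 0 < δ) (_ : δ < 1)
        (L D K : ℝ) (_ : L = 1 + Real.log (Fintype.card A * T))
        (_ : D = max 1 (d : ℝ)) (_ : K = max 1 (Real.log (N / δ))),
        μ {ω | ¬ run.regret T ω ≤ ε * M.H * T
            + C * L ^ p * √(h * (Fintype.card A : ℝ) ^ h * D * (M.H : ℝ) ^ 3 * T / ε ^ h * K)}
          ≤ ENNReal.ofReal δ ∧
        ∀ B ρ₁ ρ₂ : ℝ,
          B = (h * M.H * (Fintype.card A : ℝ) ^ h * D * K / T) ^ (1 / (h + 2)) →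
          1 ≤ ρ₁ → 1 ≤ ρ₂ → min 1 B / ρ₁ ≤ ε → ε ≤ ρ₂ * B →
          μ {ω | ¬ run.regret T ω ≤ C * L ^ p * (ρ₁ ^ (h / 2) + ρ₂)
              * ((M.H : ℝ) ^ ((h + 3) / (h + 2)) * (T : ℝ) ^ ((h + 1) / (h + 2))
                * (h * (Fintype.card A : ℝ) ^ h * D * K) ^ (1 / (h + 2)))}
            ≤ ENNReal.ofReal δ := by
  refine ⟨1, fun κ hκ => ⟨MyopicRL.regretConst κ,
    zero_lt_one.trans_le (MyopicRL.one_le_regretConst κ), ?_⟩⟩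
  intro X _ A _ _ _ _ M hM F hF G T hT ε hε0 hε Ω _ μ _ run h hh hhH hgap d hd N hN δ hδ hδ1 L D K
    hL hD hK
  subst hL hD hK
  have hTR : (1 : ℝ) ≤ T := Nat.one_le_cast.2 hT
  have ha : (1 : ℝ) ≤ Fintype.card A := Nat.one_le_cast.2 Fintype.card_pos
  have hHR : 1 ≤ (M.H : ℝ) := hh.trans hhH
  have hH : 0 < M.H := Nat.one_le_cast.1 hHR
  have hNpos : 1 ≤ N := by exact_mod_cast hN ▸ F.one_le_coverSum hF hH
  obtain ⟨hβ, hβ'⟩ := MyopicRL.radius_mem_Icc hTR (Nat.one_le_cast.2 hNpos) hδ hδ1.le ha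
  have hconfidence := run.measure_not_withinConfidence_le hM hF hT hNpos hN hδ
  have hregret {ω} := run.regret_le_of_withinConfidence (ω := ω) hM hF hH hT hε0 hκ hh hgap hd
    le_rfl (le_max_left 1 _) hβ hβ'
  have hconst := one_le_mul_of_one_le_of_one_le (MyopicRL.one_le_regretConst κ)
    (le_add_of_nonneg_right (Real.log_nonneg (one_le_mul_of_one_le_of_one_le ha hTR)))
  rw [pow_one]
  refine ⟨(measure_mono fun ω => mt fun hω => ?_).trans hconfidence, fun B ρ₁ ρ₂ hB hρ₁ hρ₂ h₁ h₂ =>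
    (measure_mono fun ω => mt fun hω => ?_).trans hconfidence⟩
  · exact (hregret hω).trans_eq (by ring_nf)
  · exact MyopicRL.le_rate_of_le (by linarith) (by linarith) hconst (by positivity) hHR
      (hregret hω) (run.regret_le hM T ω) (hB.trans (by ring_nf)) (by linarith) hρ₂ h₁ h₂
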